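/- **Conventions.** A category $\mathbb{C}$ is *bi-quasi-pointed* if it has an initial object $0$ and a terminal object $1$ and the morphism $0\to 1$ is both mono and epi. $\mathbf{BiQPointCat}$ is the 2-category of bi-quasi-pointed categories, functors preserving $0$ and $1$ (i.e. sending initial objects to initial objects and terminal objects to terminal objects), and natural transformations. A *pretorsion theory* $(\mathbb{C},\mathcal{T},\mathcal{F})$ consists of a category $\mathbb{C}$ and full replete subcategories $\mathcal{T},\mathcal{F}$; a morphism is called *null* if it factors through an object of $\mathcal{T}\cap\mathcal{F}$. It is required that (T1) every morphism from an object of $\mathcal{T}$ to an object of $\mathcal{F}$ is null; (T2) every object $X$ is equipped with a chosen short exact sequence $T^X\xrightarrow{\ell^X}X\xrightarrow{r^X}F^X$ with $T^X\in\mathcal{T}$ and $F^X\in\mathcal{F}$. Here $A\xrightarrow{\ell}X\xrightarrow{r}B$ is *short exact* if $r\ell$ is null, every $g\colon W\to X$ with $rg$ null factors uniquely through $\ell$, and every $g\colon X\to W$ with $g\ell$ null factors uniquely through $r$. The choice is normalised: $T^X=X$ and $\ell^X=\mathrm{id}$ if $X\in\mathcal{T}$, and $F^X=X$ and $r^X=\mathrm{id}$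 if $X\in\mathcal{F}$. The theory is *rectangular* if the induced functor $\mathbb{C}\to\mathcal{T}\times\mathcal{F}$, $X\mapsto(T^X,F^X)$, is an equivalence of categories. A rectangular pretorsion theory is *symmetrical* if there are bi-quasi-pointed categories $\mathbb{A},\mathbb{B}$ and an equivalence $\mathbb{C}\simeq\mathbb{A}\times\mathbb{B}$ which, in both directions, preserves torsion and torsion-free objects, where $\mathbb{A}\times\mathbb{B}$ carries the product of the pretorsion theories $(\mathbb{A},\mathbb{A},\mathbf{1})$ and $(\mathbb{B},\mathbf{0},\mathbb{B})$, that is, the torsion objects are the $(A,0)$ with $0$ initial, and the torsion-free objects are the $(1,B)$ with $1$ terminal. The category underlying a symmetrical rectangular pretorsion theory is then bi-quasi-pointed. $\mathbf{PTor}_{\mathrm{SR}}$ is the 2-category of symmetrical rectangular pretorsion theories; its 1-cells are the functors which preserve torsion objects, torsion-free objects, $0$ and $1$, and send the chosen short exact sequences to short exact sequences; its 2-cells are all natural transformations. It has an evident forgetful 2-functor to $\mathbf{BiQPointCat}$. **Theorem.** The 2-functor $M\colon\mathbf{BiQPointCat}\to\mathbf{BiQPointCat}$ given by $\mathbb{C}\mapsto\mathbb{C}\times\mathbb{C}$,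 $G\mapsto G\times G$, $\alpha\mapsto\alpha\times\alpha$, is a strict 2-monad, with unit the diagonal functors $\mathbb{C}\to\mathbb{C}\times\mathbb{C}$ and multiplication the projections $(\mathbb{C}\times\mathbb{C})\times(\mathbb{C}\times\mathbb{C})\to\mathbb{C}\times\mathbb{C}$ on the first and fourth components. Let $\mathrm{Ps}\text{-}M\text{-}\mathbf{Alg}$ be the 2-category of pseudo-algebras for $M$ (an object $\mathbb{C}$ and a 1-cell $a\colon M\mathbb{C}\to\mathbb{C}$ with invertible 2-cells $a\circ Ma\cong a\circ\mu$ and $\mathrm{id}\cong a\circ\eta$ satisfying the usual coherence axioms), pseudo-morphisms (1-cells $G$ with an invertible 2-cell $b\circ MG\cong G\circ a$ compatible with the associativity and unit 2-cells) and algebra 2-cells, with its forgetful 2-functor to $\mathbf{BiQPointCat}$. Then $\mathbf{PTor}_{\mathrm{SR}}$ and $\mathrm{Ps}\text{-}M\text{-}\mathbf{Alg}$ are 2-equivalent over $\mathbf{BiQPointCat}$: there are 2-functors $\chi\colon\mathbf{PTor}_{\mathrm{SR}}\to\mathrm{Ps}\text{-}M\text{-}\mathbf{Alg}$ and $\xi\colon\mathrm{Ps}\text{-}M\text{-}\mathbf{Alg}\to\mathbf{PTor}_{\mathrm{SR}}$,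 commuting strictly with the forgetful 2-functors, and 2-natural isomorphisms $\xi\chi\cong\mathrm{Id}$ and $\chi\xi\cong\mathrm{Id}$ whose components are sent to identities in $\mathbf{BiQPointCat}$. -/

import Mathlib

open CategoryTheory Bicategory

universe w v u w₁ v₁ u₁ w₂ v₂ u₂ w₃ v₃ u₃

/-! ### Strict 2-natural transformations, 2-monads and 2-equivalences -/

section TwoNat

variable {B : Type u₁} [Bicategory.{w₁, v₁} B] {C : Type u₂} [Bicategory.{w₂, v₂} C]
  {K : Type u₃} [Bicategory.{w₃, v₃} K]

/-- A (strict) 2-natural transformation between 2-functors. -/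
structure TwoNatTrans (F G : StrictPseudofunctor B C) where
  app (a : B) : F.obj a ⟶ G.obj a
  naturality {a b : B} (f : a ⟶ b) : F.map f ≫ app b = app a ≫ G.map f
  naturality₂ {a b : B} {f g : a ⟶ b} (θ : f ⟶ g) :
    F.map₂ θ ▷ app b ≫ eqToHom (naturality g) = eqToHom (naturality f) ≫ app a ◁ G.map₂ θ

/-- A 2-natural isomorphism: a 2-natural transformation with a strict 2-natural inverse. -/
structure TwoNatIso (F G : StrictPseudofunctor B C) where
  hom : TwoNatTrans F G
  inv : TwoNatTrans G F
  hom_inv_id (a : B) : hom.app a ≫ inv.app a = 𝟙 (F.obj a)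
  inv_hom_id (a : B) : inv.app a ≫ hom.app a = 𝟙 (G.obj a)

/-- A 2-natural transformation between 2-endofunctors of `B`, where `B` lies over `K` via `U`,
is over `K` if `U` sends all its components to identities. -/
def TwoNatTrans.IsOver {F G : StrictPseudofunctor B B} (θ : TwoNatTrans F G)
    (U : StrictPseudofunctor B K) : Prop :=
  ∀ a : B, ∃ h : U.obj (F.obj a) = U.obj (G.obj a), U.map (θ.app a) = eqToHom h

/-- A 2-equivalence over `K` between `U : B ⥤ K` and `V : C ⥤ K`: 2-functors in both directions,
strictly commuting with the 2-functors to `K`, together with 2-natural isomorphisms over `K` from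
the two composites to the identities. -/
structure TwoEquivalenceOver (U : StrictPseudofunctor B K) (V : StrictPseudofunctor C K) where
  functor : StrictPseudofunctor B C
  inverse : StrictPseudofunctor C B
  functor_over : functor.comp V = U
  inverse_over : inverse.comp U = V
  unitIso : TwoNatIso (functor.comp inverse) (StrictPseudofunctor.id B)
  counitIso : TwoNatIso (inverse.comp functor) (StrictPseudofunctor.id C)
  unitIso_over : unitIso.hom.IsOver U
  counitIso_over : counitIso.hom.IsOver V

end TwoNat

/-- A (strict) 2-monad on a (strict) 2-category. -/
structure TwoMonad (B : Type u) [Bicategory.{w, v} B] [Bicategory.Strict B] where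
  T : StrictPseudofunctor B B
  η : TwoNatTrans (StrictPseudofunctor.id B) T
  μ : TwoNatTrans (T.comp T) T
  left_unit (a : B) : η.app (T.obj a) ≫ μ.app a = 𝟙 (T.obj a)
  right_unit (a : B) : T.map (η.app a) ≫ μ.app a = 𝟙 (T.obj a)
  assoc (a : B) : T.map (μ.app a) ≫ μ.app a = μ.app (T.obj a) ≫ μ.app a

/-! ### Auxiliary calculus of 2-cells in a strict 2-category -/

namespace TwoCell

variable {B : Type u} [Bicategory.{w, v} B]

/-- A 2-cell with unspecified source and target (used only to handle strict equalities
between 1-cells in proofs). -/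
@[ext]
structure Cell (a b : B) where
  src : a ⟶ b
  tgt : a ⟶ b
  hom : src ⟶ tgt

def of {a b : B} {f g : a ⟶ b} (η : f ⟶ g) : Cell a b := ⟨f, g, η⟩

def one {a b : B} (f : a ⟶ b) : Cell a b := ⟨f, f, 𝟙 f⟩

def comp {a b : B} (x y : Cell a b) (h : x.tgt = y.src) : Cell a b :=
  ⟨x.src, y.tgt, x.hom ≫ eqToHom h ≫ y.hom⟩

def wl {a b c : B} (f : a ⟶ b) (x : Cell b c) : Cell a c := ⟨f ≫ x.src, f ≫ x.tgt, f ◁ x.hom⟩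

def wr {a b c : B} (x : Cell a b) (g : b ⟶ c) : Cell a c := ⟨x.src ≫ g, x.tgt ≫ g, x.hom ▷ g⟩

variable {a b c d : B}

@[simp] lemma src_of {f g : a ⟶ b} (η : f ⟶ g) : (of η).src = f := id rfl
@[simp] lemma tgt_of {f g : a ⟶ b} (η : f ⟶ g) : (of η).tgt = g := id rfl
@[simp] lemma src_one (f : a ⟶ b) : (one f).src = f := id rfl
@[simp] lemma tgt_one (f : a ⟶ b) : (one f).tgt = f := id rfl
@[simp] lemma src_comp (x y : Cell a b) (h) : (comp x y h).src = x.src := id rfl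
@[simp] lemma tgt_comp (x y : Cell a b) (h) : (comp x y h).tgt = y.tgt := id rfl
@[simp] lemma src_wl (f : a ⟶ b) (x : Cell b c) : (wl f x).src = f ≫ x.src := id rfl
@[simp] lemma tgt_wl (f : a ⟶ b) (x : Cell b c) : (wl f x).tgt = f ≫ x.tgt := id rfl
@[simp] lemma src_wr (x : Cell a b) (f : b ⟶ c) : (wr x f).src = x.src ≫ f := id rfl
@[simp] lemma tgt_wr (x : Cell a b) (f : b ⟶ c) : (wr x f).tgt = x.tgt ≫ f := id rfl

lemma of_inj {f g : a ⟶ b} {η θ : f ⟶ g} : of η = of θ ↔ η = θ := by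
  constructor
  · intro h; simpa [of] using h
  · rintro rfl; rfl

lemma of_hom_ext {f g f' g' : a ⟶ b} {η : f ⟶ g} {θ : f' ⟶ g'} (hf : f = f') (hg : g = g')
    (h : η ≫ eqToHom hg = eqToHom hf ≫ θ) : of η = of θ := by
  subst hf hg
  simpa [of] using h

lemma tgt_eq_src {f g h : a ⟶ b} (η : f ⟶ g) (θ : g ⟶ h) : (of η).tgt = (of θ).src := id rfl

@[simp] lemma of_comp {f g h : a ⟶ b} (η : f ⟶ g) (θ : g ⟶ h) :
    of (η ≫ θ) = comp (of η) (of θ) (tgt_eq_src η θ) := by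
  change Cell.mk f h (η ≫ θ) = Cell.mk f h (η ≫ 𝟙 g ≫ θ)
  simp

@[simp] lemma of_eqToHom {f g : a ⟶ b} (h : f = g) : of (eqToHom h) = one f := by
  subst h; rfl

@[simp] lemma of_id (f : a ⟶ b) : of (𝟙 f) = one f := rfl

@[simp] lemma of_wl (f : a ⟶ b) {g h : b ⟶ c} (η : g ⟶ h) : of (f ◁ η) = wl f (of η) := id rfl
@[simp] lemma of_wr {f g : a ⟶ b} (η : f ⟶ g) (h : b ⟶ c) : of (η ▷ h) = wr (of η) h := id rfl

@[simp] lemma comp_one (x : Cell a b) (f : a ⟶ b) (h) : comp x (one f) h = x := by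
  obtain ⟨s, t, x⟩ := x
  cases h
  simp [comp, one]

@[simp] lemma one_comp (x : Cell a b) (f : a ⟶ b) (h) : comp (one f) x h = x := by
  obtain ⟨s, t, x⟩ := x
  cases h
  simp [comp, one]

@[simp] lemma comp_assoc (x y z : Cell a b) (h h') :
    comp (comp x y h) z h' = comp x (comp y z (by simpa using h')) (by simpa using h) := by
  simp [comp]

lemma comp_congr {x x' y y' : Cell a b} (e : x = x') (e' : y = y') {h : x.tgt = y.src}
    {h' : x'.tgt = y'.src} : comp x y h = comp x' y' h' := by
  subst e e'; rfl

lemma comp_reassoc {x y w z : Cell a b} {h : x.tgt = y.src} (e : comp x y h = w)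
    {k : y.tgt = z.src} {k' : w.tgt = z.src} {h' : x.tgt = (comp y z k).src} :
    comp x (comp y z k) h' = comp w z k' := by
  subst e; simp

lemma comp_slide {p q r s t u w : Cell a b} {h₁ h₂ h₃ h₄ h₅ h₆ h₇ h₈}
    (e₁ : comp p q h₁ = comp s w h₂) (e₂ : comp w r h₃ = comp t u h₄) :
    comp p (comp q r h₅) h₆ = comp s (comp t u h₇) h₈ := by
  have h₉ : (comp s w h₂).tgt = r.src := by simpa using h₃
  rw [comp_reassoc e₁ (k' := h₉), comp_assoc]
  exact comp_congr rfl e₂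

lemma comp_chain {p₁ p₂ p₃ p₄ p₃' p₂' q₁ q₂ r : Cell a b} {h₁ h₂ h₃ h₄ h₅ h₆ h₇ h₈ h₉ h₁₀}
    (e₁ : comp p₂ p₃ h₁ = comp p₃' p₂' h₂) (e₂ : comp p₂' p₄ h₃ = comp q₁ q₂ h₄)
    (e₃ : comp p₁ (comp p₃' q₁ h₅) h₆ = r) :
    comp p₁ (comp p₂ (comp p₃ p₄ h₇) h₈) h₉ = comp r q₂ h₁₀ := by
  subst e₃
  simp only [comp_assoc]
  exact comp_congr rfl (comp_slide e₁ e₂)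

@[simp] lemma wl_one (f : a ⟶ b) (g : b ⟶ c) : wl f (one g) = one (f ≫ g) := by
  simp [wl, one]

@[simp] lemma wr_one (f : a ⟶ b) (g : b ⟶ c) : wr (one f) g = one (f ≫ g) := by
  simp [wr, one]

@[simp] lemma wl_comp (f : a ⟶ b) (x y : Cell b c) (h) :
    wl f (comp x y h) = comp (wl f x) (wl f y) (by simp [h]) := by
  simp [wl, comp]

@[simp] lemma wr_comp (x y : Cell a b) (g : b ⟶ c) (h) :
    wr (comp x y h) g = comp (wr x g) (wr y g) (by simp [h]) := by
  simp [wr, comp]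

lemma exchange (x : Cell a b) (y : Cell b c) :
    comp (wl x.src y) (wr x y.tgt) rfl = comp (wr x y.src) (wl x.tgt y) rfl := by
  simp [wl, wr, comp, whisker_exchange]

lemma exchange' (x : Cell a b) (y : Cell b c) {f g h k} (hf : x.src = f) (hg : x.tgt = g)
    (hh : y.src = h) (hk : y.tgt = k) :
    comp (wl f y) (wr x k) (by simp [hf, hk]) = comp (wr x h) (wl g y) (by simp [hh, hg]) := by
  subst hf hg hh hk
  exact exchange x y

section

variable [Strict B]

@[simp] lemma id_wl (x : Cell a b) : wl (𝟙 a) x = x := by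
  obtain ⟨s, t, x⟩ := x
  exact of_hom_ext (Strict.id_comp s) (Strict.id_comp t) (by simp [Strict.leftUnitor_eqToIso])

@[simp] lemma wr_id (x : Cell a b) : wr x (𝟙 b) = x := by
  obtain ⟨s, t, x⟩ := x
  exact of_hom_ext (Strict.comp_id s) (Strict.comp_id t) (by simp [Strict.rightUnitor_eqToIso])

@[simp] lemma wl_wl (f : a ⟶ b) (g : b ⟶ c) (x : Cell c d) : wl (f ≫ g) x = wl f (wl g x) := by
  obtain ⟨s, t, x⟩ := x
  exact of_hom_ext (Strict.assoc f g s) (Strict.assoc f g t)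
    (by simp [Strict.associator_eqToIso, wl])

@[simp] lemma wr_wr (x : Cell a b) (f : b ⟶ c) (g : c ⟶ d) : wr x (f ≫ g) = wr (wr x f) g := by
  obtain ⟨s, t, x⟩ := x
  exact of_hom_ext (Strict.assoc s f g).symm (Strict.assoc t f g).symm
    (by simp [Strict.associator_eqToIso, wr])

@[simp] lemma wr_wl (f : a ⟶ b) (x : Cell b c) (g : c ⟶ d) :
    wr (wl f x) g = wl f (wr x g) := by
  obtain ⟨s, t, x⟩ := x
  exact of_hom_ext (Strict.assoc f s g) (Strict.assoc f t g)
    (by simp [Strict.associator_eqToIso, wl, wr])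

end

section

variable {C : Type u₂} [Bicategory.{w₂, v₂} C] (F : StrictPseudofunctor B C)

def map (x : Cell a b) : Cell (F.obj a) (F.obj b) := ⟨F.map x.src, F.map x.tgt, F.map₂ x.hom⟩

@[simp] lemma src_map (x : Cell a b) : (map F x).src = F.map x.src := id rfl
@[simp] lemma tgt_map (x : Cell a b) : (map F x).tgt = F.map x.tgt := id rfl

@[simp] lemma of_map₂ {f g : a ⟶ b} (η : f ⟶ g) : of (F.map₂ η) = map F (of η) := id rfl

@[simp] lemma map_one (f : a ⟶ b) : map F (one f) = one (F.map f) := by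
  simp [map, one]

@[simp] lemma map_comp (x y : Cell a b) (h) :
    map F (comp x y h) = comp (map F x) (map F y) (by simp [h]) := by
  simp [map, comp, PrelaxFunctor.map₂_eqToHom]

@[simp] lemma map_wl (f : a ⟶ b) (x : Cell b c) : map F (wl f x) = wl (F.map f) (map F x) := by
  obtain ⟨s, t, x⟩ := x
  exact of_hom_ext (F.map_comp f s) (F.map_comp f t)
    (by simp [F.mapComp_eq_eqToIso, wl, map])

@[simp] lemma map_wr (x : Cell a b) (g : b ⟶ c) : map F (wr x g) = wr (map F x) (F.map g) := by
  obtain ⟨s, t, x⟩ := x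
  exact of_hom_ext (F.map_comp s g) (F.map_comp t g)
    (by simp [F.mapComp_eq_eqToIso, wr, map])

lemma nat {F G : StrictPseudofunctor B C} (θ : TwoNatTrans F G) (x : Cell a b) :
    wr (map F x) (θ.app b) = wl (θ.app a) (map G x) := by
  obtain ⟨s, t, x⟩ := x
  exact of_hom_ext (θ.naturality s) (θ.naturality t) (θ.naturality₂ x)

end

end TwoCell

/-! ### Pseudo-algebras for a 2-monad -/

section PseudoAlg

variable {B : Type u} [Bicategory.{w, v} B] [Strict B]

namespace TwoMonad

variable (M : TwoMonad B)

/-- The components of the unit of a 2-monad. -/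
def unit (a : B) : a ⟶ M.T.obj a := M.η.app a

/-- The components of the multiplication of a 2-monad. -/
def mult (a : B) : M.T.obj (M.T.obj a) ⟶ M.T.obj a := M.μ.app a

lemma unit_mult (a : B) : M.unit (M.T.obj a) ≫ M.mult a = 𝟙 _ := M.left_unit a
lemma map_unit_mult (a : B) : M.T.map (M.unit a) ≫ M.mult a = 𝟙 _ := M.right_unit a
lemma map_mult_mult (a : B) :
    M.T.map (M.mult a) ≫ M.mult a = M.mult (M.T.obj a) ≫ M.mult a := M.assoc a
lemma unit_nat {a b : B} (f : a ⟶ b) : f ≫ M.unit b = M.unit a ≫ M.T.map f :=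
  M.η.naturality f
lemma mult_nat {a b : B} (f : a ⟶ b) :
    M.T.map (M.T.map f) ≫ M.mult b = M.mult a ≫ M.T.map f := M.μ.naturality f

section

variable {a b c : B}

lemma unit_mult_assoc (f : M.T.obj a ⟶ b) : M.unit (M.T.obj a) ≫ M.mult a ≫ f = f := by
  rw [← Strict.assoc, M.unit_mult, Strict.id_comp]
lemma map_unit_mult_assoc (f : M.T.obj a ⟶ b) : M.T.map (M.unit a) ≫ M.mult a ≫ f = f := by
  rw [← Strict.assoc, M.map_unit_mult, Strict.id_comp]
lemma map_mult_mult_assoc (f : M.T.obj a ⟶ b) :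
    M.T.map (M.mult a) ≫ M.mult a ≫ f = M.mult (M.T.obj a) ≫ M.mult a ≫ f := by
  rw [← Strict.assoc, M.map_mult_mult, Strict.assoc]
lemma unit_nat_assoc (f : a ⟶ b) (g : M.T.obj b ⟶ c) :
    f ≫ M.unit b ≫ g = M.unit a ≫ M.T.map f ≫ g := by
  rw [← Strict.assoc, M.unit_nat, Strict.assoc]
lemma mult_nat_assoc (f : a ⟶ b) (g : M.T.obj b ⟶ c) :
    M.T.map (M.T.map f) ≫ M.mult b ≫ g = M.mult a ≫ M.T.map f ≫ g := by
  rw [← Strict.assoc, M.mult_nat, Strict.assoc]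
lemma map_comp_assoc (f : a ⟶ b) (g : b ⟶ c) {d : B} (h : M.T.obj c ⟶ d) :
    M.T.map (f ≫ g) ≫ h = M.T.map f ≫ M.T.map g ≫ h := by
  rw [M.T.map_comp, Strict.assoc]

end

end TwoMonad

/-- A pseudo-algebra for a 2-monad `M`: the `eqToHom`s only insert equalities of 1-cells which
hold by strictness, 2-naturality and the monad laws. -/
structure PseudoAlgebra (M : TwoMonad B) where
  carrier : B
  str : M.T.obj carrier ⟶ carrier
  assoc : M.T.map str ≫ str ≅ M.mult carrier ≫ str
  unit : 𝟙 carrier ≅ M.unit carrier ≫ str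
  assoc_coh :
    M.T.map₂ assoc.hom ▷ str ≫ eqToHom (M.map_comp_assoc _ _ _) ≫
        M.T.map (M.mult carrier) ◁ assoc.hom ≫ eqToHom (M.map_mult_mult_assoc str) =
      eqToHom (M.map_comp_assoc _ _ _) ≫ M.T.map (M.T.map str) ◁ assoc.hom ≫
        eqToHom (M.mult_nat_assoc str str) ≫ M.mult (M.T.obj carrier) ◁ assoc.hom
  unit_left_coh :
    str ◁ unit.hom ≫ eqToHom (M.unit_nat_assoc str str) ≫
        M.unit (M.T.obj carrier) ◁ assoc.hom =
      eqToHom ((Strict.comp_id str).trans (M.unit_mult_assoc str).symm)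
  unit_right_coh :
    M.T.map₂ unit.hom ▷ str ≫ eqToHom (M.map_comp_assoc _ _ _) ≫
        M.T.map (M.unit carrier) ◁ assoc.hom =
      eqToHom (by rw [M.T.map_id, Strict.id_comp, M.map_unit_mult_assoc])

variable {M : TwoMonad B}

/-- A pseudo-morphism of pseudo-algebras. -/
structure PseudoMorphism (X Y : PseudoAlgebra M) where
  hom : X.carrier ⟶ Y.carrier
  iso : M.T.map hom ≫ Y.str ≅ X.str ≫ hom
  assoc_coh :
    M.T.map₂ iso.hom ▷ Y.str ≫ eqToHom (M.map_comp_assoc _ _ _) ≫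
        M.T.map X.str ◁ iso.hom ≫ eqToHom (Strict.assoc _ _ _).symm ≫ X.assoc.hom ▷ hom =
      eqToHom (M.map_comp_assoc _ _ _) ≫ M.T.map (M.T.map hom) ◁ Y.assoc.hom ≫
        eqToHom (M.mult_nat_assoc hom Y.str) ≫ M.mult X.carrier ◁ iso.hom ≫
        eqToHom (Strict.assoc _ _ _).symm
  unit_coh :
    hom ◁ Y.unit.hom ≫ eqToHom (M.unit_nat_assoc hom Y.str) ≫ M.unit X.carrier ◁ iso.hom =
      eqToHom ((Strict.comp_id hom).trans (Strict.id_comp hom).symm) ≫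
        X.unit.hom ▷ hom ≫ eqToHom (Strict.assoc _ _ _)

/-- A 2-cell between pseudo-morphisms of pseudo-algebras. -/
@[ext]
structure PseudoTwoCell {X Y : PseudoAlgebra M} (f g : PseudoMorphism X Y) where
  cell : f.hom ⟶ g.hom
  comm : M.T.map₂ cell ▷ Y.str ≫ g.iso.hom = f.iso.hom ≫ X.str ◁ cell

namespace TwoCell

lemma mult_nat {a b c : B} (x : Cell a b) (f : M.T.obj b ⟶ c) :
    wr (wr (map M.T (map M.T x)) (M.mult b)) f = wl (M.mult a) (wr (map M.T x) f) := by
  rw [← wr_wl]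
  exact congrArg (wr · f) (nat M.μ x)

lemma unit_nat {a b c : B} (x : Cell a b) (f : M.T.obj b ⟶ c) :
    wr (wr x (M.unit b)) f = wl (M.unit a) (wr (map M.T x) f) := by
  rw [← wr_wl]
  refine congrArg (wr · f) ?_
  exact nat M.η x

end TwoCell

namespace PseudoMorphism

open TwoCell

variable {X Y Z : PseudoAlgebra M}

lemma cell_assoc (f : PseudoMorphism X Y) :
    TwoCell.comp (wr (map M.T (of f.iso.hom)) Y.str)
        (TwoCell.comp (wl (M.T.map X.str) (of f.iso.hom)) (wr (of X.assoc.hom) f.hom)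
          (by simp))
        (by simp [M.map_comp_assoc]) =
      TwoCell.comp (wl (M.T.map (M.T.map f.hom)) (of Y.assoc.hom))
        (wl (M.mult X.carrier) (of f.iso.hom)) (by simp [M.mult_nat_assoc]) := by
  simpa using of_inj.2 f.assoc_coh

lemma cell_unit (f : PseudoMorphism X Y) :
    TwoCell.comp (wl f.hom (of Y.unit.hom)) (wl (M.unit X.carrier) (of f.iso.hom))
        (by simp [M.unit_nat_assoc]) =
      wr (of X.unit.hom) f.hom := by
  simpa using of_inj.2 f.unit_coh

lemma hom_ext {f g : PseudoMorphism X Y} (h : f.hom = g.hom)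
    (h' : of f.iso.hom = of g.iso.hom) : f = g := by
  obtain ⟨f, φ, _, _⟩ := f
  obtain ⟨g, ψ, _, _⟩ := g
  dsimp only at h
  subst h
  have : φ = ψ := Iso.ext (of_inj.1 h')
  subst this
  rfl

/-- The identity pseudo-morphism. -/
def id (X : PseudoAlgebra M) : PseudoMorphism X X where
  hom := 𝟙 X.carrier
  iso := eqToIso (by rw [M.T.map_id, Strict.id_comp, Strict.comp_id])
  assoc_coh := by
    apply of_inj.1
    simp [M.T.map_id, -Bicategory.comp_whiskerLeft,
      -Bicategory.whiskerRight_comp, -Bicategory.whisker_assoc,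
      -Bicategory.id_whiskerLeft, -Bicategory.whiskerRight_id, -Pseudofunctor.map₂_whisker_left,
      -Pseudofunctor.map₂_whisker_right]
  unit_coh := by
    apply of_inj.1
    simp [-Bicategory.comp_whiskerLeft,
      -Bicategory.whiskerRight_comp, -Bicategory.whisker_assoc,
      -Bicategory.id_whiskerLeft, -Bicategory.whiskerRight_id, -Pseudofunctor.map₂_whisker_left,
      -Pseudofunctor.map₂_whisker_right]

/-- The composite of two pseudo-morphisms. -/
def comp (f : PseudoMorphism X Y) (g : PseudoMorphism Y Z) : PseudoMorphism X Z where
  hom := f.hom ≫ g.hom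
  iso := eqToIso (M.map_comp_assoc _ _ _) ≪≫ M.T.map f.hom ◁ᵢ g.iso ≪≫
    eqToIso (Strict.assoc _ _ _).symm ≪≫ f.iso ▷ᵢ g.hom ≪≫ eqToIso (Strict.assoc _ _ _)
  assoc_coh := by
    apply of_inj.1
    simp [M.T.map_comp, -Bicategory.comp_whiskerLeft,
      -Bicategory.whiskerRight_comp, -Bicategory.whisker_assoc,
      -Bicategory.id_whiskerLeft, -Bicategory.whiskerRight_id, -Pseudofunctor.map₂_whisker_left,
      -Pseudofunctor.map₂_whisker_right]
    have e₁ : TwoCell.comp (wl (M.T.map (M.T.map f.hom)) (wl (M.T.map Y.str) (of g.iso.hom)))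
        (wr (wr (map M.T (of f.iso.hom)) Y.str) g.hom) (by simp [M.T.map_comp]) =
        TwoCell.comp (wr (wr (map M.T (of f.iso.hom)) (M.T.map g.hom)) Z.str)
          (wl (M.T.map X.str) (wl (M.T.map f.hom) (of g.iso.hom)))
          (by simp [M.T.map_comp]) := by
      simpa [M.T.map_comp] using exchange (map M.T (of f.iso.hom)) (of g.iso.hom)
    have e₂ := congrArg (wr · g.hom) f.cell_assoc
    have e₃ := congrArg (wl (M.T.map (M.T.map f.hom))) g.cell_assoc
    have e₄ : wl (M.T.map (M.T.map f.hom)) (wl (M.mult Y.carrier) (of g.iso.hom)) =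
        wl (M.mult X.carrier) (wl (M.T.map f.hom) (of g.iso.hom)) := by
      rw [← wl_wl, M.mult_nat, wl_wl]
    simp only [wl_comp, wr_comp, wr_wl, e₄] at e₂ e₃
    refine (comp_chain (h₁₀ := ?_) e₁.symm e₂ e₃).trans ?_
    · simp
    · simp
  unit_coh := by
    apply of_inj.1
    simp [-Bicategory.comp_whiskerLeft,
      -Bicategory.whiskerRight_comp, -Bicategory.whisker_assoc,
      -Bicategory.id_whiskerLeft, -Bicategory.whiskerRight_id, -Pseudofunctor.map₂_whisker_left,
      -Pseudofunctor.map₂_whisker_right]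
    have e₁ := congrArg (wl f.hom) g.cell_unit
    have e₂ := congrArg (wr · g.hom) f.cell_unit
    have e₃ : wl f.hom (wl (M.unit Y.carrier) (of g.iso.hom)) =
        wl (M.unit X.carrier) (wl (M.T.map f.hom) (of g.iso.hom)) := by
      rw [← wl_wl, M.unit_nat, wl_wl]
    simp only [wl_comp, wr_comp, wr_wl, e₃] at e₁ e₂
    exact (comp_reassoc e₁).trans e₂

end PseudoMorphism

namespace PseudoTwoCell

open TwoCell

variable {X Y Z : PseudoAlgebra M}

lemma cell_comm {f g : PseudoMorphism X Y} (θ : PseudoTwoCell f g) :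
    TwoCell.comp (wr (map M.T (of θ.cell)) Y.str) (of g.iso.hom) (by simp) =
      TwoCell.comp (of f.iso.hom) (wl X.str (of θ.cell)) (by simp) := by
  simpa using of_inj.2 θ.comm

/-- A 2-cell whose underlying 2-cell is an equality of 1-cells. -/
def ofEq {f g : PseudoMorphism X Y} (θ : f.hom ⟶ g.hom) (h : f = g)
    (hθ : θ = eqToHom (congrArg PseudoMorphism.hom h)) : PseudoTwoCell f g where
  cell := θ
  comm := by
    subst h hθ
    simp

/-- Left whiskering. -/
def whiskerLeft (f : PseudoMorphism X Y) {g h : PseudoMorphism Y Z} (θ : PseudoTwoCell g h) :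
    PseudoTwoCell (f.comp g) (f.comp h) where
  cell := f.hom ◁ θ.cell
  comm := by
    apply of_inj.1
    have e₁ := congrArg (wl (M.T.map f.hom)) θ.cell_comm
    have e₂ := exchange (of f.iso.hom) (of θ.cell)
    simp [PseudoMorphism.comp, -Bicategory.comp_whiskerLeft,
      -Bicategory.whiskerRight_comp, -Bicategory.whisker_assoc,
      -Bicategory.id_whiskerLeft, -Bicategory.whiskerRight_id, -Pseudofunctor.map₂_whisker_left,
      -Pseudofunctor.map₂_whisker_right] at e₁ e₂ ⊢
    exact comp_slide e₁ e₂

/-- Right whiskering. -/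
def whiskerRight {f g : PseudoMorphism X Y} (θ : PseudoTwoCell f g) (h : PseudoMorphism Y Z) :
    PseudoTwoCell (f.comp h) (g.comp h) where
  cell := θ.cell ▷ h.hom
  comm := by
    apply of_inj.1
    have e₁ := congrArg (wr · h.hom) θ.cell_comm
    have e₂ := exchange (map M.T (of θ.cell)) (of h.iso.hom)
    simp [PseudoMorphism.comp, -Bicategory.comp_whiskerLeft,
      -Bicategory.whiskerRight_comp, -Bicategory.whisker_assoc,
      -Bicategory.id_whiskerLeft, -Bicategory.whiskerRight_id, -Pseudofunctor.map₂_whisker_left,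
      -Pseudofunctor.map₂_whisker_right] at e₁ e₂ ⊢
    exact comp_slide e₂.symm e₁

end PseudoTwoCell

namespace PseudoAlgebra

open TwoCell

instance : CategoryStruct (PseudoAlgebra M) where
  Hom X Y := PseudoMorphism X Y
  id X := PseudoMorphism.id X
  comp f g := PseudoMorphism.comp f g

instance (X Y : PseudoAlgebra M) : Category (X ⟶ Y) where
  Hom f g := PseudoTwoCell (X := X) (Y := Y) f g
  id f := ⟨𝟙 _, by simp⟩
  comp θ θ' := ⟨θ.cell ≫ θ'.cell, by
    rw [M.T.map₂_comp, comp_whiskerRight, Category.assoc, θ'.comm, ← Category.assoc, θ.comm,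
      Category.assoc, whiskerLeft_comp]⟩
  id_comp θ := PseudoTwoCell.ext (Category.id_comp _)
  comp_id θ := PseudoTwoCell.ext (Category.comp_id _)
  assoc θ θ' θ'' := PseudoTwoCell.ext (Category.assoc _ _ _)

lemma id_comp' {X Y : PseudoAlgebra M} (f : X ⟶ Y) : 𝟙 X ≫ f = f := by
  refine PseudoMorphism.hom_ext (Strict.id_comp _) ?_
  change of (PseudoMorphism.comp (PseudoMorphism.id X) f).iso.hom = _
  simp [PseudoMorphism.comp, PseudoMorphism.id, M.T.map_id, -Bicategory.comp_whiskerLeft,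
      -Bicategory.whiskerRight_comp, -Bicategory.whisker_assoc,
      -Bicategory.id_whiskerLeft, -Bicategory.whiskerRight_id]

lemma comp_id' {X Y : PseudoAlgebra M} (f : X ⟶ Y) : f ≫ 𝟙 Y = f := by
  refine PseudoMorphism.hom_ext (Strict.comp_id _) ?_
  change of (PseudoMorphism.comp f (PseudoMorphism.id Y)).iso.hom = _
  simp [PseudoMorphism.comp, PseudoMorphism.id, M.T.map_id, -Bicategory.comp_whiskerLeft,
      -Bicategory.whiskerRight_comp, -Bicategory.whisker_assoc,
      -Bicategory.id_whiskerLeft, -Bicategory.whiskerRight_id]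

lemma assoc' {X Y Z W : PseudoAlgebra M} (f : X ⟶ Y) (g : Y ⟶ Z) (h : Z ⟶ W) :
    (f ≫ g) ≫ h = f ≫ g ≫ h := by
  refine PseudoMorphism.hom_ext (Strict.assoc _ _ _) ?_
  change of (PseudoMorphism.comp (PseudoMorphism.comp f g) h).iso.hom =
    of (PseudoMorphism.comp f (PseudoMorphism.comp g h)).iso.hom
  simp [PseudoMorphism.comp, M.T.map_comp, -Bicategory.comp_whiskerLeft,
      -Bicategory.whiskerRight_comp, -Bicategory.whisker_assoc,
      -Bicategory.id_whiskerLeft, -Bicategory.whiskerRight_id]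

/-- An invertible 2-cell whose underlying 2-cell is an equality of 1-cells. -/
def isoOfEq {X Y : PseudoAlgebra M} {f g : X ⟶ Y} (e : f.hom ≅ g.hom) (h : f = g)
    (he : e = eqToIso (congrArg PseudoMorphism.hom h)) : f ≅ g where
  hom := PseudoTwoCell.ofEq e.hom h (by rw [he]; rfl)
  inv := PseudoTwoCell.ofEq e.inv h.symm (by rw [he]; rfl)
  hom_inv_id := PseudoTwoCell.ext e.hom_inv_id
  inv_hom_id := PseudoTwoCell.ext e.inv_hom_id

lemma isoOfEq_eq {X Y : PseudoAlgebra M} {f g : X ⟶ Y} (e : f.hom ≅ g.hom) (h : f = g)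
    (he : e = eqToIso (congrArg PseudoMorphism.hom h)) : isoOfEq e h he = eqToIso h := by
  subst h he
  rfl

/-- The 2-category of pseudo-algebras, pseudo-morphisms and 2-cells of a 2-monad. -/
instance : Bicategory (PseudoAlgebra M) where
  whiskerLeft f _ _ θ := PseudoTwoCell.whiskerLeft f θ
  whiskerRight θ h := PseudoTwoCell.whiskerRight θ h
  associator f g h := isoOfEq (α_ f.hom g.hom h.hom) (assoc' f g h)
    (Strict.associator_eqToIso _ _ _)
  leftUnitor f := isoOfEq (λ_ f.hom) (id_comp' f) (Strict.leftUnitor_eqToIso _)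
  rightUnitor f := isoOfEq (ρ_ f.hom) (comp_id' f) (Strict.rightUnitor_eqToIso _)
  whiskerLeft_id _ _ := PseudoTwoCell.ext (whiskerLeft_id _ _)
  whiskerLeft_comp _ _ _ _ _ _ := PseudoTwoCell.ext (whiskerLeft_comp _ _ _)
  id_whiskerLeft _ := PseudoTwoCell.ext (id_whiskerLeft _)
  comp_whiskerLeft _ _ _ _ _ := PseudoTwoCell.ext (comp_whiskerLeft _ _ _)
  id_whiskerRight _ _ := PseudoTwoCell.ext (id_whiskerRight _ _)
  comp_whiskerRight _ _ _ := PseudoTwoCell.ext (comp_whiskerRight _ _ _)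
  whiskerRight_id _ := PseudoTwoCell.ext (whiskerRight_id _)
  whiskerRight_comp _ _ _ := PseudoTwoCell.ext (whiskerRight_comp _ _ _)
  whisker_assoc _ _ _ _ _ := PseudoTwoCell.ext (whisker_assoc _ _ _)
  whisker_exchange _ _ := PseudoTwoCell.ext (whisker_exchange _ _)
  pentagon _ _ _ _ := PseudoTwoCell.ext (pentagon _ _ _ _)
  triangle _ _ := PseudoTwoCell.ext (triangle _ _)

instance : Strict (PseudoAlgebra M) where
  id_comp := id_comp'
  comp_id := comp_id'
  assoc := assoc'
  leftUnitor_eqToIso _ := isoOfEq_eq _ _ _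
  rightUnitor_eqToIso _ := isoOfEq_eq _ _ _
  associator_eqToIso _ _ _ := isoOfEq_eq _ _ _

/-- The forgetful 2-functor from pseudo-algebras to the base 2-category. -/
def forget (M : TwoMonad B) : StrictPseudofunctor (PseudoAlgebra M) B :=
  StrictPseudofunctor.mk''
    { obj := PseudoAlgebra.carrier
      map := PseudoMorphism.hom
      map₂ := PseudoTwoCell.cell
      map₂_id := fun _ => rfl
      map₂_comp := fun _ _ => rfl
      map_id := fun _ => rfl
      map_comp := fun _ _ => rfl
      map₂_whisker_left := fun _ _ _ _ =>
        ((Category.id_comp _).trans (Category.comp_id _)).symm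
      map₂_whisker_right := fun _ _ =>
        ((Category.id_comp _).trans (Category.comp_id _)).symm }

end PseudoAlgebra

end PseudoAlg

/-! ### Bi-quasi-pointed categories -/

section BiQuasiPointed

/-- The initial objects of a category. -/
def initialObjects (C : Type u) [Category.{v} C] : ObjectProperty C :=
  fun X => Nonempty (Limits.IsInitial X)

/-- The terminal objects of a category. -/
def terminalObjects (C : Type u) [Category.{v} C] : ObjectProperty C :=
  fun X => Nonempty (Limits.IsTerminal X)

/-- A category is bi-quasi-pointed if it has an initial object `0` and a terminal object `1`, and
the morphism `0 ⟶ 1` is both mono and epi. -/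
structure IsBiQuasiPointed (C : Type u) [Category.{v} C] : Prop where
  exists_initial : ∃ X, initialObjects C X
  exists_terminal : ∃ X, terminalObjects C X
  mono {X Y : C} (f : X ⟶ Y) : initialObjects C X → terminalObjects C Y → Mono f
  epi {X Y : C} (f : X ⟶ Y) : initialObjects C X → terminalObjects C Y → Epi f

section Facts

variable {C : Type u} [Category.{v} C] {D : Type u₁} [Category.{v₁} D]

lemma initialObjects_of {X : C} (h : ∀ Y, Nonempty (Unique (X ⟶ Y))) : initialObjects C X :=
  ⟨Limits.IsInitial.ofUniqueHom (fun Y => (h Y).some.default) (fun Y => (h Y).some.uniq)⟩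

lemma terminalObjects_of {X : C} (h : ∀ Y, Nonempty (Unique (Y ⟶ X))) : terminalObjects C X :=
  ⟨Limits.IsTerminal.ofUniqueHom (fun Y => (h Y).some.default) (fun Y => (h Y).some.uniq)⟩

lemma initialObjects_prod_iff (X : C × D) :
    initialObjects (C × D) X ↔ initialObjects C X.1 ∧ initialObjects D X.2 := by
  constructor
  · rintro ⟨h⟩
    refine ⟨initialObjects_of fun Y => ⟨⟨⟨(h.to (Y, X.2)).1⟩, fun f => ?_⟩⟩,
      initialObjects_of fun Y => ⟨⟨⟨(h.to (X.1, Y)).2⟩, fun f => ?_⟩⟩⟩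
    · exact congrArg Prod.fst (h.hom_ext (Y := (Y, X.2)) (f, (h.to (Y, X.2)).2) (h.to (Y, X.2)))
    · exact congrArg Prod.snd (h.hom_ext (Y := (X.1, Y)) ((h.to (X.1, Y)).1, f) (h.to (X.1, Y)))
  · rintro ⟨⟨h₁⟩, ⟨h₂⟩⟩
    exact ⟨Limits.IsInitial.ofUniqueHom (fun Y => (h₁.to Y.1, h₂.to Y.2))
      (fun Y f => Prod.ext (h₁.hom_ext _ _) (h₂.hom_ext _ _))⟩

lemma terminalObjects_prod_iff (X : C × D) :
    terminalObjects (C × D) X ↔ terminalObjects C X.1 ∧ terminalObjects D X.2 := by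
  constructor
  · rintro ⟨h⟩
    refine ⟨terminalObjects_of fun Y => ⟨⟨⟨(h.from (Y, X.2)).1⟩, fun f => ?_⟩⟩,
      terminalObjects_of fun Y => ⟨⟨⟨(h.from (X.1, Y)).2⟩, fun f => ?_⟩⟩⟩
    · exact congrArg Prod.fst
        (h.hom_ext (Y := (Y, X.2)) (f, (h.from (Y, X.2)).2) (h.from (Y, X.2)))
    · exact congrArg Prod.snd
        (h.hom_ext (Y := (X.1, Y)) ((h.from (X.1, Y)).1, f) (h.from (X.1, Y)))
  · rintro ⟨⟨h₁⟩, ⟨h₂⟩⟩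
    exact ⟨Limits.IsTerminal.ofUniqueHom (fun Y => (h₁.from Y.1, h₂.from Y.2))
      (fun Y f => Prod.ext (h₁.hom_ext _ _) (h₂.hom_ext _ _))⟩

lemma IsBiQuasiPointed.prod (hC : IsBiQuasiPointed C) (hD : IsBiQuasiPointed D) :
    IsBiQuasiPointed (C × D) where
  exists_initial := by
    obtain ⟨X, hX⟩ := hC.exists_initial
    obtain ⟨Y, hY⟩ := hD.exists_initial
    exact ⟨(X, Y), (initialObjects_prod_iff (X, Y)).2 ⟨hX, hY⟩⟩
  exists_terminal := by
    obtain ⟨X, hX⟩ := hC.exists_terminal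
    obtain ⟨Y, hY⟩ := hD.exists_terminal
    exact ⟨(X, Y), (terminalObjects_prod_iff (X, Y)).2 ⟨hX, hY⟩⟩
  mono {X Y} f hX hY := by
    rw [initialObjects_prod_iff] at hX
    rw [terminalObjects_prod_iff] at hY
    have h₁ := hC.mono f.1 hX.1 hY.1
    have h₂ := hD.mono f.2 hX.2 hY.2
    exact ⟨fun g h e => Prod.ext ((cancel_mono f.1).1 (congrArg Prod.fst e))
      ((cancel_mono f.2).1 (congrArg Prod.snd e))⟩
  epi {X Y} f hX hY := by
    rw [initialObjects_prod_iff] at hX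
    rw [terminalObjects_prod_iff] at hY
    have h₁ := hC.epi f.1 hX.1 hY.1
    have h₂ := hD.epi f.2 hX.2 hY.2
    exact ⟨fun g h e => Prod.ext ((cancel_epi f.1).1 (congrArg Prod.fst e))
      ((cancel_epi f.2).1 (congrArg Prod.snd e))⟩

lemma initialObjects_equivalence (e : C ≌ D) {X : C} (hX : initialObjects C X) :
    initialObjects D (e.functor.obj X) :=
  ⟨hX.some.isInitialObj e.functor X⟩

lemma terminalObjects_equivalence (e : C ≌ D) {X : C} (hX : terminalObjects C X) :
    terminalObjects D (e.functor.obj X) :=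
  ⟨hX.some.isTerminalObj e.functor X⟩

lemma IsBiQuasiPointed.of_equivalence (e : C ≌ D) (hD : IsBiQuasiPointed D) :
    IsBiQuasiPointed C where
  exists_initial := by
    obtain ⟨X, hX⟩ := hD.exists_initial
    exact ⟨e.inverse.obj X, initialObjects_equivalence e.symm hX⟩
  exists_terminal := by
    obtain ⟨X, hX⟩ := hD.exists_terminal
    exact ⟨e.inverse.obj X, terminalObjects_equivalence e.symm hX⟩
  mono f hX hY := by
    have := hD.mono (e.functor.map f) (initialObjects_equivalence e hX)
      (terminalObjects_equivalence e hY)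
    exact e.functor.mono_of_mono_map this
  epi f hX hY := by
    have := hD.epi (e.functor.map f) (initialObjects_equivalence e hX)
      (terminalObjects_equivalence e hY)
    exact e.functor.epi_of_epi_map this

end Facts

/-- A bi-quasi-pointed category. -/
structure BiQPointCat : Type (max (u + 1) (v + 1)) where
  carrier : Type u
  [category : Category.{v} carrier]
  isBiQuasiPointed : IsBiQuasiPointed carrier

attribute [instance] BiQPointCat.category

namespace BiQPointCat

/-- A functor preserving `0` and `1`. -/
structure Hom (C D : BiQPointCat.{v, u}) where
  functor : C.carrier ⥤ D.carrier
  map_initial : ∀ X, initialObjects C.carrier X → initialObjects D.carrier (functor.obj X)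
  map_terminal : ∀ X, terminalObjects C.carrier X → terminalObjects D.carrier (functor.obj X)

instance : CategoryStruct BiQPointCat.{v, u} where
  Hom := Hom
  id C := ⟨𝟭 C.carrier, fun _ h => h, fun _ h => h⟩
  comp F G := ⟨F.functor ⋙ G.functor, fun X h => G.map_initial _ (F.map_initial X h),
    fun X h => G.map_terminal _ (F.map_terminal X h)⟩

instance (C D : BiQPointCat.{v, u}) : Category (C ⟶ D) where
  Hom F G := NatTrans F.functor G.functor
  id F := NatTrans.id F.functor
  comp α β := NatTrans.vcomp α β
  id_comp _ := NatTrans.ext (funext fun _ => Category.id_comp _)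
  comp_id _ := NatTrans.ext (funext fun _ => Category.comp_id _)
  assoc _ _ _ := NatTrans.ext (funext fun _ => Category.assoc _ _ _)

/-- The 2-category of bi-quasi-pointed categories, functors preserving `0` and `1`, and natural
transformations. -/
instance : Bicategory BiQPointCat.{v, u} where
  homCategory C D := inferInstanceAs (Category (C ⟶ D))
  whiskerLeft F _ _ α := Functor.whiskerLeft F.functor α
  whiskerRight α G := Functor.whiskerRight α G.functor
  associator F G H := Iso.refl (F ≫ G ≫ H)
  leftUnitor F := Iso.refl F
  rightUnitor F := Iso.refl F
  whiskerLeft_id _ _ := rfl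
  whiskerLeft_comp _ _ _ _ _ _ := rfl
  id_whiskerLeft _ := NatTrans.ext (funext fun _ =>
    ((Category.id_comp _).trans (Category.comp_id _)).symm)
  comp_whiskerLeft _ _ _ _ _ := NatTrans.ext (funext fun _ =>
    ((Category.id_comp _).trans (Category.comp_id _)).symm)
  id_whiskerRight _ G := NatTrans.ext (funext fun _ => G.functor.map_id _)
  comp_whiskerRight _ _ G := NatTrans.ext (funext fun _ => G.functor.map_comp _ _)
  whiskerRight_id _ := NatTrans.ext (funext fun _ =>
    ((Category.id_comp _).trans (Category.comp_id _)).symm)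
  whiskerRight_comp _ _ _ := NatTrans.ext (funext fun _ =>
    ((Category.id_comp _).trans (Category.comp_id _)).symm)
  whisker_assoc _ _ _ _ _ := NatTrans.ext (funext fun _ =>
    ((Category.id_comp _).trans (Category.comp_id _)).symm)
  whisker_exchange α β := NatTrans.ext (funext fun X => (β.naturality (α.app X)).symm)
  pentagon F G H I := NatTrans.ext (funext fun X => by
    change I.functor.map (𝟙 (H.functor.obj (G.functor.obj (F.functor.obj X)))) ≫ 𝟙 _ ≫ 𝟙 _ =
      𝟙 _ ≫ 𝟙 _
    rw [I.functor.map_id, Category.id_comp])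
  triangle _ G := NatTrans.ext (funext fun _ =>
    (Category.id_comp _).trans (G.functor.map_id _).symm)

instance : Strict BiQPointCat.{v, u} where
  id_comp _ := rfl
  comp_id _ := rfl
  assoc _ _ _ := rfl
  leftUnitor_eqToIso _ := rfl
  rightUnitor_eqToIso _ := rfl
  associator_eqToIso _ _ _ := rfl

/-- The square of a bi-quasi-pointed category. -/
abbrev sq (C : BiQPointCat.{v, u}) : BiQPointCat.{v, u} :=
  ⟨C.carrier × C.carrier, C.isBiQuasiPointed.prod C.isBiQuasiPointed⟩

/-- The 2-functor sending `C` to `C × C`, `G` to `G × G` and `α` to `α × α`. -/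
def squareFunctor : StrictPseudofunctor BiQPointCat.{v, u} BiQPointCat.{v, u} :=
  StrictPseudofunctor.mk''
    { obj := sq
      map := fun G =>
        { functor := G.functor.prod G.functor
          map_initial := fun X h => (initialObjects_prod_iff _).2
            ⟨G.map_initial _ ((initialObjects_prod_iff X).1 h).1,
              G.map_initial _ ((initialObjects_prod_iff X).1 h).2⟩
          map_terminal := fun X h => (terminalObjects_prod_iff _).2
            ⟨G.map_terminal _ ((terminalObjects_prod_iff X).1 h).1,
              G.map_terminal _ ((terminalObjects_prod_iff X).1 h).2⟩ }
      map₂ := fun α => NatTrans.prod α α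
      map₂_id := fun _ => rfl
      map₂_comp := fun _ _ => rfl
      map_id := fun _ => rfl
      map_comp := fun _ _ => rfl
      map₂_whisker_left := fun _ _ _ _ =>
        ((Category.id_comp _).trans (Category.comp_id _)).symm
      map₂_whisker_right := fun _ _ =>
        ((Category.id_comp _).trans (Category.comp_id _)).symm }

/-- The diagonal functors `C ⥤ C × C`, as a 2-natural transformation. -/
def diagonal : TwoNatTrans (StrictPseudofunctor.id BiQPointCat.{v, u}) squareFunctor where
  app C :=
    { functor := Functor.diag C.carrier
      map_initial := fun X h => (initialObjects_prod_iff (X, X)).2 ⟨h, h⟩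
      map_terminal := fun X h => (terminalObjects_prod_iff (X, X)).2 ⟨h, h⟩ }
  naturality _ := rfl
  naturality₂ _ := (Category.comp_id _).trans (Category.id_comp _).symm

/-- The projections `(C × C) × (C × C) ⥤ C × C` on the first and fourth components, as a 2-natural
transformation. -/
def projection : TwoNatTrans (squareFunctor.comp squareFunctor) squareFunctor.{v, u} where
  app C :=
    { functor := (CategoryTheory.Prod.fst C.carrier C.carrier).prod
        (CategoryTheory.Prod.snd C.carrier C.carrier)
      map_initial := fun X h => by
        have h' := (initialObjects_prod_iff X).1 h
        exact (initialObjects_prod_iff _).2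
          ⟨((initialObjects_prod_iff X.1).1 h'.1).1, ((initialObjects_prod_iff X.2).1 h'.2).2⟩
      map_terminal := fun X h => by
        have h' := (terminalObjects_prod_iff X).1 h
        exact (terminalObjects_prod_iff _).2
          ⟨((terminalObjects_prod_iff X.1).1 h'.1).1, ((terminalObjects_prod_iff X.2).1 h'.2).2⟩ }
  naturality _ := rfl
  naturality₂ _ := (Category.comp_id _).trans (Category.id_comp _).symm

/-- The 2-monad `C ↦ C × C` on bi-quasi-pointed categories. -/
def squareMonad : TwoMonad BiQPointCat.{v, u} where
  T := squareFunctor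
  η := diagonal
  μ := projection
  left_unit _ := rfl
  right_unit _ := rfl
  assoc _ := rfl

end BiQPointCat

end BiQuasiPointed

/-! ### Pretorsion theories -/

section Pretorsion

/-- A morphism is null relative to a class `Z` of objects if it factors through an object of `Z`. -/
def IsNull {C : Type u} [Category.{v} C] (Z : ObjectProperty C) {X Y : C} (f : X ⟶ Y) : Prop :=
  ∃ (W : C) (_ : Z W) (g : X ⟶ W) (h : W ⟶ Y), g ≫ h = f

/-- A sequence `A ⟶ X ⟶ B` is short exact relative to `Z` if `ℓ` is a kernel of `r` and `r` is a
cokernel of `ℓ` with respect to the null morphisms. -/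
structure IsShortExact {C : Type u} [Category.{v} C] (Z : ObjectProperty C) {A X B : C}
    (ℓ : A ⟶ X) (r : X ⟶ B) : Prop where
  null : IsNull Z (ℓ ≫ r)
  kernel {W : C} (g : W ⟶ X) : IsNull Z (g ≫ r) → ∃! k : W ⟶ A, k ≫ ℓ = g
  cokernel {W : C} (g : X ⟶ W) : IsNull Z (ℓ ≫ g) → ∃! k : B ⟶ W, r ≫ k = g

/-- A pretorsion theory on a category `C`: full replete subcategories `tors` and `free` satisfying
the axioms (T1) and (T2), equipped with a choice of a short exact sequence for every object, which
is trivial on the left for torsion objects and trivial on the right for torsion-free objects. -/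
structure PretorsionTheory (C : Type u) [Category.{v} C] where
  tors : ObjectProperty C
  free : ObjectProperty C
  tors_iso : tors.IsClosedUnderIsomorphisms
  free_iso : free.IsClosedUnderIsomorphisms
  null_of_tors_of_free {X Y : C} (f : X ⟶ Y) : tors X → free Y → IsNull (tors ⊓ free) f
  torsPart : C → C
  freePart : C → C
  tors_torsPart (X : C) : tors (torsPart X)
  free_freePart (X : C) : free (freePart X)
  ℓ (X : C) : torsPart X ⟶ X
  r (X : C) : X ⟶ freePart X
  exact (X : C) : IsShortExact (tors ⊓ free) (ℓ X) (r X)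
  ℓ_of_tors (X : C) : tors X → ∃ h : torsPart X = X, ℓ X = eqToHom h
  r_of_free (X : C) : free X → ∃ h : X = freePart X, r X = eqToHom h

section

variable {C : Type u} [Category.{v} C] {Z : ObjectProperty C}

lemma IsNull.comp_left {X Y W : C} {f : X ⟶ Y} (hf : IsNull Z f) (g : W ⟶ X) :
    IsNull Z (g ≫ f) := by
  obtain ⟨V, hV, a, b, rfl⟩ := hf
  exact ⟨V, hV, g ≫ a, b, Category.assoc _ _ _⟩

lemma IsNull.comp_right {X Y W : C} {f : X ⟶ Y} (hf : IsNull Z f) (g : Y ⟶ W) :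
    IsNull Z (f ≫ g) := by
  obtain ⟨V, hV, a, b, rfl⟩ := hf
  exact ⟨V, hV, a, b ≫ g, (Category.assoc _ _ _).symm⟩

namespace IsShortExact

variable {A X B : C} {ℓ : A ⟶ X} {r : X ⟶ B}

lemma mono (h : IsShortExact Z ℓ r) : Mono ℓ where
  right_cancellation f g e :=
    (h.kernel (f ≫ ℓ) (by rw [Category.assoc]; exact h.null.comp_left f)).unique rfl e.symm

lemma epi (h : IsShortExact Z ℓ r) : Epi r where
  left_cancellation f g e :=
    (h.cokernel (r ≫ f) (by rw [← Category.assoc]; exact h.null.comp_right f)).unique rfl e.symm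

lemma of_iso (h : IsShortExact Z ℓ r) {A' B' : C} (e : A' ≅ A) (e' : B ≅ B') :
    IsShortExact Z (e.hom ≫ ℓ) (r ≫ e'.hom) where
  null := by
    have := (h.null.comp_left e.hom).comp_right e'.hom
    simpa using this
  kernel g hg := by
    have := h.mono
    obtain ⟨k, hk, -⟩ := h.kernel g (by simpa using hg.comp_right e'.inv)
    refine ⟨k ≫ e.inv, by simpa using hk, fun k' hk' => ?_⟩
    rw [← cancel_mono e.hom, ← cancel_mono ℓ]
    simpa [hk] using hk'
  cokernel g hg := by
    have := h.epi
    obtain ⟨k, hk, -⟩ := h.cokernel g (by simpa using hg.comp_left e.inv)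
    refine ⟨e'.inv ≫ k, by simpa using hk, fun k' hk' => ?_⟩
    rw [← cancel_epi e'.hom, ← cancel_epi r]
    simpa [hk] using hk'

end IsShortExact

namespace PretorsionTheory

variable (P : PretorsionTheory C)

/-- The null objects of a pretorsion theory. -/
abbrev null : ObjectProperty C := P.tors ⊓ P.free

instance (X : C) : Mono (P.ℓ X) := (P.exact X).mono

instance (X : C) : Epi (P.r X) := (P.exact X).epi

lemma exists_iso_of_isShortExact {A X B : C} {ℓ : A ⟶ X} {r : X ⟶ B}
    (h : IsShortExact P.null ℓ r) (hA : P.tors A) (hB : P.free B) :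
    ∃ (e : A ≅ P.torsPart X) (e' : P.freePart X ≅ B), ℓ = e.hom ≫ P.ℓ X ∧ r = P.r X ≫ e'.hom := by
  have := h.mono
  have := h.epi
  obtain ⟨a, ha, -⟩ := (P.exact X).kernel ℓ
    (P.null_of_tors_of_free _ hA (P.free_freePart X))
  obtain ⟨b, hb, -⟩ := h.kernel (P.ℓ X) (P.null_of_tors_of_free _ (P.tors_torsPart X) hB)
  obtain ⟨c, hc, -⟩ := (P.exact X).cokernel r
    (P.null_of_tors_of_free _ (P.tors_torsPart X) hB)
  obtain ⟨d, hd, -⟩ := h.cokernel (P.r X) (P.null_of_tors_of_free _ hA (P.free_freePart X))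
  refine ⟨⟨a, b, ?_, ?_⟩, ⟨c, d, ?_, ?_⟩, ha.symm, hc.symm⟩
  · rw [← cancel_mono ℓ, Category.assoc, hb, ha, Category.id_comp]
  · rw [← cancel_mono (P.ℓ X), Category.assoc, ha, hb, Category.id_comp]
  · rw [← cancel_epi (P.r X), ← Category.assoc, hc, hd, Category.comp_id]
  · rw [← cancel_epi r, ← Category.assoc, hd, hc, Category.comp_id]

lemma exists_torsMap {X Y : C} (h : X ⟶ Y) : ∃! k, k ≫ P.ℓ Y = P.ℓ X ≫ h :=
  (P.exact Y).kernel _ (P.null_of_tors_of_free _ (P.tors_torsPart X) (P.free_freePart Y))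

lemma exists_freeMap {X Y : C} (h : X ⟶ Y) : ∃! k, P.r X ≫ k = h ≫ P.r Y :=
  (P.exact X).cokernel _ (P.null_of_tors_of_free _ (P.tors_torsPart X) (P.free_freePart Y))

/-- The morphism induced on torsion parts. -/
noncomputable def torsMap {X Y : C} (h : X ⟶ Y) : P.torsPart X ⟶ P.torsPart Y :=
  (P.exists_torsMap h).choose

/-- The morphism induced on torsion-free parts. -/
noncomputable def freeMap {X Y : C} (h : X ⟶ Y) : P.freePart X ⟶ P.freePart Y :=
  (P.exists_freeMap h).choose

lemma torsMap_ℓ {X Y : C} (h : X ⟶ Y) : P.torsMap h ≫ P.ℓ Y = P.ℓ X ≫ h :=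
  (P.exists_torsMap h).choose_spec.1

lemma r_freeMap {X Y : C} (h : X ⟶ Y) : P.r X ≫ P.freeMap h = h ≫ P.r Y :=
  (P.exists_freeMap h).choose_spec.1

/-- The functor taking an object to its torsion part. -/
noncomputable def torsFunctor : C ⥤ P.tors.FullSubcategory :=
  P.tors.lift
    { obj := P.torsPart
      map := P.torsMap
      map_id := fun X => by rw [← cancel_mono (P.ℓ X), torsMap_ℓ]; simp
      map_comp := fun f g => by
        rw [← cancel_mono (P.ℓ _), torsMap_ℓ, Category.assoc, torsMap_ℓ, ← Category.assoc,
          ← Category.assoc, torsMap_ℓ] }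
    P.tors_torsPart

/-- The functor taking an object to its torsion-free part. -/
noncomputable def freeFunctor : C ⥤ P.free.FullSubcategory :=
  P.free.lift
    { obj := P.freePart
      map := P.freeMap
      map_id := fun X => by rw [← cancel_epi (P.r X), r_freeMap]; simp
      map_comp := fun f g => by
        rw [← cancel_epi (P.r _), r_freeMap, ← Category.assoc, r_freeMap, Category.assoc,
          Category.assoc, r_freeMap] }
    P.free_freePart

/-- A pretorsion theory is rectangular if the canonical functor to the product of the torsion and
torsion-free subcategories is an equivalence. -/
def IsRectangular : Prop := (P.torsFunctor.prod' P.freeFunctor).IsEquivalence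

end PretorsionTheory

end

/-- The product of classes of objects. -/
def prodObjects {C : Type u} [Category.{v} C] {D : Type u₁} [Category.{v₁} D]
    (P : ObjectProperty C) (Q : ObjectProperty D) : ObjectProperty (C × D) :=
  fun X => P X.1 ∧ Q X.2

/-- An equivalence of categories which, in both directions, preserves torsion and torsion-free
objects. -/
structure IsPretorsionEquivalence {C : Type u} [Category.{v} C] {D : Type u₁} [Category.{v₁} D]
    (e : C ≌ D) (T F : ObjectProperty C) (T' F' : ObjectProperty D) : Prop where
  functor_tors (X : C) : T X → T' (e.functor.obj X)
  functor_free (X : C) : F X → F' (e.functor.obj X)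
  inverse_tors (X : D) : T' X → T (e.inverse.obj X)
  inverse_free (X : D) : F' X → F (e.inverse.obj X)

/-- A rectangular pretorsion theory is symmetrical if it is equivalent to a product of the
pretorsion theories `(A, A, 1)` and `(B, 0, B)` with `A` and `B` bi-quasi-pointed. -/
def PretorsionTheory.IsSymmetrical {C : Type u} [Category.{v} C] (P : PretorsionTheory C) : Prop :=
  ∃ (A B : Type u) (_ : Category.{v} A) (_ : Category.{v} B),
    IsBiQuasiPointed A ∧ IsBiQuasiPointed B ∧ ∃ e : C ≌ A × B,
      IsPretorsionEquivalence e P.tors P.free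
        (prodObjects ⊤ (initialObjects B)) (prodObjects (terminalObjects A) ⊤)

lemma PretorsionTheory.IsSymmetrical.isBiQuasiPointed {C : Type u} [Category.{v} C]
    {P : PretorsionTheory C} (h : P.IsSymmetrical) : IsBiQuasiPointed C := by
  obtain ⟨A, B, _, _, hA, hB, e, -⟩ := h
  exact (hA.prod hB).of_equivalence e

/-- A symmetrical rectangular pretorsion theory. -/
structure PTorSR : Type (max (u + 1) (v + 1)) where
  carrier : Type u
  [category : Category.{v} carrier]
  theory : PretorsionTheory carrier
  isRectangular : theory.IsRectangular
  isSymmetrical : theory.IsSymmetrical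

attribute [instance] PTorSR.category

namespace PTorSR

/-- The underlying bi-quasi-pointed category. -/
abbrev toBiQPointCat (P : PTorSR.{v, u}) : BiQPointCat.{v, u} :=
  ⟨P.carrier, P.isSymmetrical.isBiQuasiPointed⟩

/-- A morphism of symmetrical rectangular pretorsion theories: a functor preserving `0` and `1`,
torsion and torsion-free objects, and sending chosen short exact sequences to short exact
sequences. -/
structure Hom (P Q : PTorSR.{v, u}) extends BiQPointCat.Hom P.toBiQPointCat Q.toBiQPointCat where
  map_tors (X : P.carrier) : P.theory.tors X → Q.theory.tors (functor.obj X)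
  map_free (X : P.carrier) : P.theory.free X → Q.theory.free (functor.obj X)
  map_exact (X : P.carrier) :
    IsShortExact Q.theory.null (functor.map (P.theory.ℓ X)) (functor.map (P.theory.r X))

instance : CategoryStruct PTorSR.{v, u} where
  Hom := Hom
  id P :=
    { toHom := 𝟙 P.toBiQPointCat
      map_tors := fun _ h => h
      map_free := fun _ h => h
      map_exact := P.theory.exact }
  comp {P Q R} F G :=
    { toHom := (show P.toBiQPointCat ⟶ Q.toBiQPointCat from F.toHom) ≫
        (show Q.toBiQPointCat ⟶ R.toBiQPointCat from G.toHom)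
      map_tors := fun X h => G.map_tors _ (F.map_tors X h)
      map_free := fun X h => G.map_free _ (F.map_free X h)
      map_exact := fun X => by
        obtain ⟨e, e', h, h'⟩ := Q.theory.exists_iso_of_isShortExact (F.map_exact X)
          (F.map_tors _ (P.theory.tors_torsPart X)) (F.map_free _ (P.theory.free_freePart X))
        have := (G.map_exact (F.functor.obj X)).of_iso (G.functor.mapIso e) (G.functor.mapIso e')
        rw [Functor.mapIso_hom, Functor.mapIso_hom, ← Functor.map_comp, ← Functor.map_comp, ← h,
          ← h'] at this
        exact this }

/-- The underlying 1-cell of bi-quasi-pointed categories. -/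
abbrev toBiQPointHom {P Q : PTorSR.{v, u}} (F : P ⟶ Q) : P.toBiQPointCat ⟶ Q.toBiQPointCat :=
  Hom.toHom F

instance (P Q : PTorSR.{v, u}) : Category (P ⟶ Q) where
  Hom F G := toBiQPointHom F ⟶ toBiQPointHom G
  id F := 𝟙 (toBiQPointHom F)
  comp α β := CategoryStruct.comp (obj := P.toBiQPointCat ⟶ Q.toBiQPointCat) α β
  id_comp _ := Category.id_comp (obj := P.toBiQPointCat ⟶ Q.toBiQPointCat) _
  comp_id _ := Category.comp_id (obj := P.toBiQPointCat ⟶ Q.toBiQPointCat) _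
  assoc _ _ _ := Category.assoc (obj := P.toBiQPointCat ⟶ Q.toBiQPointCat) _ _ _

/-- The 2-category of symmetrical rectangular pretorsion theories, their morphisms and natural
transformations. -/
instance : Bicategory PTorSR.{v, u} where
  homCategory P Q := inferInstanceAs (Category (P ⟶ Q))
  whiskerLeft F _ _ α := Bicategory.whiskerLeft (toBiQPointHom F) α
  whiskerRight α G := Bicategory.whiskerRight (B := BiQPointCat) α (toBiQPointHom G)
  associator F G H := Iso.refl (F ≫ G ≫ H)
  leftUnitor F := Iso.refl F
  rightUnitor F := Iso.refl F
  whiskerLeft_id _ _ := rfl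
  whiskerLeft_comp _ _ _ _ _ _ := rfl
  id_whiskerLeft _ := id_whiskerLeft (B := BiQPointCat) _
  comp_whiskerLeft _ _ _ _ _ := comp_whiskerLeft (B := BiQPointCat) _ _ _
  id_whiskerRight _ _ := id_whiskerRight (B := BiQPointCat) _ _
  comp_whiskerRight _ _ _ := comp_whiskerRight (B := BiQPointCat) _ _ _
  whiskerRight_id _ := whiskerRight_id (B := BiQPointCat) _
  whiskerRight_comp _ _ _ := whiskerRight_comp (B := BiQPointCat) _ _ _
  whisker_assoc _ _ _ _ _ := whisker_assoc (B := BiQPointCat) _ _ _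
  whisker_exchange _ _ := whisker_exchange (B := BiQPointCat) _ _
  pentagon _ _ _ _ := pentagon (B := BiQPointCat) _ _ _ _
  triangle _ _ := triangle (B := BiQPointCat) _ _

instance : Strict PTorSR.{v, u} where
  id_comp _ := rfl
  comp_id _ := rfl
  assoc _ _ _ := rfl
  leftUnitor_eqToIso _ := rfl
  rightUnitor_eqToIso _ := rfl
  associator_eqToIso _ _ _ := rfl

/-- The forgetful 2-functor from symmetrical rectangular pretorsion theories to bi-quasi-pointed
categories. -/
def forget : StrictPseudofunctor PTorSR.{v, u} BiQPointCat.{v, u} :=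
  StrictPseudofunctor.mk''
    { obj := toBiQPointCat
      map := toBiQPointHom
      map₂ := fun α => α
      map₂_id := fun _ => rfl
      map₂_comp := fun _ _ => rfl
      map_id := fun _ => rfl
      map_comp := fun _ _ => rfl
      map₂_whisker_left := fun _ _ _ _ =>
        ((Category.id_comp _).trans (Category.comp_id _)).symm
      map₂_whisker_right := fun _ _ =>
        ((Category.id_comp _).trans (Category.comp_id _)).symm }

end PTorSR

end Pretorsion

/-! ### The pretorsion theory carried by a decomposition as a product -/

section ProductTheory

variable {C : Type u} [Category.{v} C] {D : Type u₁} [Category.{v₁} D]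
  {A : Type u₂} [Category.{v₂} A] {B : Type u₃} [Category.{v₃} B]

/-! A pseudo-algebra for `C ↦ C × C` is a rectangular band up to coherent isomorphism: an operation
`X·Y` with `X ≅ X·X` and `(X·Y)·(Z·W) ≅ X·W`. A rectangular band of sets is a product of two sets
with `(a, b)·(a', b') = (a, b')`, and the categorical version behaves alike: such an operation
amounts to a decomposition `C ≌ A × B`. A symmetrical rectangular pretorsion theory is also a
decomposition `C ≌ A × B`, its torsion objects being the `(A, 0)` and its torsion-free objects the
`(1, B)`. The two structures are matched through a common decomposition (`RectBand.Associated`).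

To decompose a band, fix an initial object `U`. Up to isomorphism `X·U` depends only on the first
factor of `X` and `U·X` only on the second, and `X` is recovered from the pair; this gives an
equivalence of `C` with a product (`RectBand.isEquivalence_prod'`), whose factors inherit
bi-quasi-pointedness (`RectBand.exists_splits`).

For morphisms, call a functor `s` left if it inverts all `s(X·g)`. It then has a comparison `s(X·Y)
≅ s(X)`, the only one natural in `Y` and unital (`eq_leftHom`), and this is automatically compatible
with associativity (`α_leftHom`). The first projection of a decomposition is left and the second is
right. Testing against both shows that a functor carries at most one pseudo-morphism structure, that
every natural transformation respects these structures (`RectBand.Hom.comm`), and that the structure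
exists once the functor preserves the morphisms inverted by each projection (`Compatible`). Among
functors preserving `0` and `1` the same condition singles out the morphisms of pretorsion theories,
because a sequence from a torsion to a torsion-free object is short exact exactly when its first map
is invertible in `A` and its second in `B` (`isShortExact_iff`).

So both 2-categories have the same 1-cells and 2-cells over bi-quasi-pointed categories, and the
comparison 2-natural isomorphisms are carried by identity functors. -/

/-- After composition with the monomorphism `0 ⟶ 1` both maps land in a terminal object. With its
dual, this supplies uniqueness of factorizations through kernels and cokernels in the component
where nothing is invertible. -/
lemma IsBiQuasiPointed.hom_initial_ext (h : IsBiQuasiPointed C) {W I : C}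
    (hI : initialObjects C I) (f g : W ⟶ I) : f = g := by
  obtain ⟨J, ⟨hJ⟩⟩ := h.exists_terminal
  have := h.mono (hJ.from I) hI ⟨hJ⟩
  rw [← cancel_mono (hJ.from I)]
  exact hJ.hom_ext _ _

lemma IsBiQuasiPointed.terminal_hom_ext (h : IsBiQuasiPointed C) {J W : C}
    (hJ : terminalObjects C J) (f g : J ⟶ W) : f = g := by
  obtain ⟨I, ⟨hI⟩⟩ := h.exists_initial
  have := h.epi (hI.to J) ⟨hI⟩ hJ
  rw [← cancel_epi (hI.to J)]
  exact hI.hom_ext _ _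

/-- Parallel maps into an initial object of `A` become, when paired with an identity, parallel maps
into an initial object of `A × B`, and these agree. The dual argument at a terminal object gives the
epi condition. -/
lemma IsBiQuasiPointed.fst_of_prod (h : IsBiQuasiPointed (A × B)) : IsBiQuasiPointed A where
  exists_initial := by
    obtain ⟨X, hX⟩ := h.exists_initial
    exact ⟨X.1, ((initialObjects_prod_iff X).1 hX).1⟩
  exists_terminal := by
    obtain ⟨X, hX⟩ := h.exists_terminal
    exact ⟨X.1, ((terminalObjects_prod_iff X).1 hX).1⟩
  mono {X Y} f hX hY := by
    obtain ⟨I, hI⟩ := h.exists_initial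
    refine ⟨fun {W} g k _ => congrArg Prod.fst (h.hom_initial_ext (W := (W, I.2)) (I := (X, I.2))
      ?_ (g, 𝟙 _) (k, 𝟙 _))⟩
    exact (initialObjects_prod_iff _).2 ⟨hX, ((initialObjects_prod_iff I).1 hI).2⟩
  epi {X Y} f hX hY := by
    obtain ⟨J, hJ⟩ := h.exists_terminal
    refine ⟨fun {W} g k _ => congrArg Prod.fst (h.terminal_hom_ext (J := (Y, J.2)) (W := (W, J.2))
      ?_ (g, 𝟙 _) (k, 𝟙 _))⟩
    exact (terminalObjects_prod_iff _).2 ⟨hY, ((terminalObjects_prod_iff J).1 hJ).2⟩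

lemma IsBiQuasiPointed.snd_of_prod (h : IsBiQuasiPointed (A × B)) : IsBiQuasiPointed B :=
  IsBiQuasiPointed.fst_of_prod (h.of_equivalence (Prod.braiding B A))

lemma isIso_of_initialObjects {X Y : C} (hX : initialObjects C X) (hY : initialObjects C Y)
    (f : X ⟶ Y) : IsIso f :=
  ⟨hY.some.to X, hX.some.hom_ext _ _, hY.some.hom_ext _ _⟩

lemma isIso_of_terminalObjects {X Y : C} (hX : terminalObjects C X) (hY : terminalObjects C Y)
    (f : X ⟶ Y) : IsIso f :=
  ⟨hX.some.from Y, hX.some.hom_ext _ _, hY.some.hom_ext _ _⟩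

lemma initialObjects_of_iso {X Y : C} (e : X ≅ Y) (hX : initialObjects C X) :
    initialObjects C Y :=
  ⟨hX.some.ofIso e⟩

lemma terminalObjects_of_iso {X Y : C} (e : X ≅ Y) (hX : terminalObjects C X) :
    terminalObjects C Y :=
  ⟨hX.some.ofIso e⟩

lemma isIso_iff_fst_snd {X Y : A × B} (f : X ⟶ Y) : IsIso f ↔ IsIso f.1 ∧ IsIso f.2 :=
  isIso_prod_iff A B (P := X.1) (Q := Y.1) (S := X.2) (T := Y.2)

namespace CategoryTheory.Equivalence

variable (e : C ≌ A × B)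

/-- The objects with initial second component under an equivalence with a product. -/
def tors : ObjectProperty C := fun X => initialObjects B (e.functor.obj X).2

/-- The objects with terminal first component under an equivalence with a product. -/
def free : ObjectProperty C := fun X => terminalObjects A (e.functor.obj X).1

variable {e}

lemma hom_ext_prod {X Y : C} {f g : X ⟶ Y} (h₁ : (e.functor.map f).1 = (e.functor.map g).1)
    (h₂ : (e.functor.map f).2 = (e.functor.map g).2) : f = g :=
  e.functor.map_injective (Prod.ext h₁ h₂)

variable (e) in
lemma exists_map_eq {X Y : C} (a : (e.functor.obj X).1 ⟶ (e.functor.obj Y).1)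
    (b : (e.functor.obj X).2 ⟶ (e.functor.obj Y).2) :
    ∃ f : X ⟶ Y, (e.functor.map f).1 = a ∧ (e.functor.map f).2 = b := by
  obtain ⟨f, hf⟩ := e.functor.map_surjective (X := X) (Y := Y) (a, b)
  exact ⟨f, by rw [hf], by rw [hf]⟩

lemma map_comp_fst {X Y Z : C} (f : X ⟶ Y) (g : Y ⟶ Z) :
    (e.functor.map (f ≫ g)).1 = (e.functor.map f).1 ≫ (e.functor.map g).1 := by
  rw [e.functor.map_comp]; rfl

lemma map_comp_snd {X Y Z : C} (f : X ⟶ Y) (g : Y ⟶ Z) :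
    (e.functor.map (f ≫ g)).2 = (e.functor.map f).2 ≫ (e.functor.map g).2 := by
  rw [e.functor.map_comp]; rfl

lemma map_id_fst (X : C) : (e.functor.map (𝟙 X)).1 = 𝟙 _ := by
  rw [e.functor.map_id]; rfl

lemma map_id_snd (X : C) : (e.functor.map (𝟙 X)).2 = 𝟙 _ := by
  rw [e.functor.map_id]; rfl

/-- The first component of the equivalence applied to an isomorphism. -/
def mapIsoFst (e : C ≌ A × B) {X Y : C} (i : X ≅ Y) :
    (e.functor.obj X).1 ≅ (e.functor.obj Y).1 :=
  (CategoryTheory.Prod.fst A B).mapIso (e.functor.mapIso i)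

/-- The second component of the equivalence applied to an isomorphism. -/
def mapIsoSnd (e : C ≌ A × B) {X Y : C} (i : X ≅ Y) :
    (e.functor.obj X).2 ≅ (e.functor.obj Y).2 :=
  (CategoryTheory.Prod.snd A B).mapIso (e.functor.mapIso i)

variable (e) in
lemma isIso_iff {X Y : C} (f : X ⟶ Y) :
    IsIso f ↔ IsIso (e.functor.map f).1 ∧ IsIso (e.functor.map f).2 := by
  rw [← isIso_iff_fst_snd, isIso_iff_of_reflects_iso]

lemma tors_of_iso {X Y : C} (i : X ≅ Y) (h : e.tors X) : e.tors Y :=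
  initialObjects_of_iso (e.mapIsoSnd i) h

lemma free_of_iso {X Y : C} (i : X ≅ Y) (h : e.free X) : e.free Y :=
  terminalObjects_of_iso (e.mapIsoFst i) h

variable (e) in
lemma exists_obj (a : A) (b : B) : ∃ X : C, Nonempty ((e.functor.obj X).1 ≅ a) ∧
    Nonempty ((e.functor.obj X).2 ≅ b) :=
  ⟨e.inverse.obj (a, b), ⟨(CategoryTheory.Prod.fst A B).mapIso (e.counitIso.app (a, b))⟩,
    ⟨(CategoryTheory.Prod.snd A B).mapIso (e.counitIso.app (a, b))⟩⟩

/-- The morphism factors through an object with components `(1, 0)`: its first component ends in a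
terminal object and its second starts from an initial one, so there is nothing to check. -/
lemma isNull_of_tors_of_free (hA : IsBiQuasiPointed A) (hB : IsBiQuasiPointed B) {X Y : C}
    (f : X ⟶ Y) (hX : e.tors X) (hY : e.free Y) : IsNull (e.tors ⊓ e.free) f := by
  obtain ⟨J, hJ⟩ := hA.exists_terminal
  obtain ⟨I, hI⟩ := hB.exists_initial
  obtain ⟨Z, ⟨i⟩, ⟨j⟩⟩ := e.exists_obj J I
  obtain ⟨g, hg⟩ := e.exists_map_eq (X := X) (Y := Z) (hJ.some.from _ ≫ i.inv) (hX.some.to _)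
  obtain ⟨h, hh⟩ := e.exists_map_eq (X := Z) (Y := Y) (hY.some.from _) (j.hom ≫ hI.some.to _)
  exact ⟨Z, ⟨initialObjects_of_iso j.symm hI, terminalObjects_of_iso i.symm hJ⟩, g, h,
    hom_ext_prod (hY.some.hom_ext _ _) (hX.some.hom_ext _ _)⟩

/-- In the first component the kernel factorization is forced by inverting `l`. In the second it
must pass through the initial object that a null morphism provides, and it is unique because
parallel maps into an initial object agree. Cokernels are dual. -/
lemma isShortExact_of_isIso (hA : IsBiQuasiPointed A) (hB : IsBiQuasiPointed B) {T X F : C}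
    {l : T ⟶ X} {r : X ⟶ F} (hT : e.tors T) (hF : e.free F) (hl : IsIso (e.functor.map l).1)
    (hr : IsIso (e.functor.map r).2) : IsShortExact (e.tors ⊓ e.free) l r where
  null := isNull_of_tors_of_free hA hB _ hT hF
  kernel {W} g hg := by
    obtain ⟨Z, hZ, m, n, hmn⟩ := hg
    obtain ⟨k, hk₁, hk₂⟩ := e.exists_map_eq (X := W) (Y := T)
      ((e.functor.map g).1 ≫ inv (e.functor.map l).1) ((e.functor.map m).2 ≫ hZ.1.some.to _)
    refine ⟨k, hom_ext_prod (e := e) ?_ ?_, fun k' hk' =>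
      hom_ext_prod (e := e) ?_ (hB.hom_initial_ext hT _ _)⟩
    · rw [map_comp_fst, hk₁, Category.assoc, IsIso.inv_hom_id, Category.comp_id]
    -- The second component of `r` is invertible, so the equation may be tested after composing with
    -- it; both sides then factor through the second component of the null object `Z`, which is
    -- initial.
    · rw [map_comp_snd, hk₂, Category.assoc, ← cancel_mono (e.functor.map r).2, ← map_comp_snd,
        ← hmn, map_comp_snd, Category.assoc, Category.assoc]
      exact congrArg ((e.functor.map m).2 ≫ ·) (hZ.1.some.hom_ext _ _)
    · rw [hk₁, ← hk', map_comp_fst, Category.assoc, IsIso.hom_inv_id, Category.comp_id]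
  cokernel {W} g hg := by
    obtain ⟨Z, hZ, m, n, hmn⟩ := hg
    obtain ⟨k, hk₁, hk₂⟩ := e.exists_map_eq (X := F) (Y := W)
      (hZ.2.some.from _ ≫ (e.functor.map n).1) (inv (e.functor.map r).2 ≫ (e.functor.map g).2)
    refine ⟨k, hom_ext_prod (e := e) ?_ ?_, fun k' hk' =>
      hom_ext_prod (e := e) (hA.terminal_hom_ext hF _ _) ?_⟩
    · rw [map_comp_fst, hk₁, ← cancel_epi (e.functor.map l).1, ← map_comp_fst (f := l) (g := g),
        ← hmn, map_comp_fst, ← Category.assoc, ← Category.assoc]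
      exact congrArg (· ≫ (e.functor.map n).1) (hZ.2.some.hom_ext _ _)
    · rw [map_comp_snd, hk₂, IsIso.hom_inv_id_assoc]
    · rw [hk₂, ← hk', map_comp_snd, IsIso.inv_hom_id_assoc]

variable (e) in
-- The torsion part has components `(X₁, 0)`; the case distinction serves the normalisation, which
-- demands `X` itself with the identity when `X` is already torsion.
lemma exists_torsPart (hB : IsBiQuasiPointed B) (X : C) :
    ∃ (T : C) (l : T ⟶ X), e.tors T ∧ IsIso (e.functor.map l).1 ∧
      (e.tors X → ∃ h : T = X, l = eqToHom h) := by
  by_cases h : e.tors X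
  · exact ⟨X, 𝟙 X, h, by rw [map_id_fst]; infer_instance, fun _ => ⟨rfl, rfl⟩⟩
  · obtain ⟨I, hI⟩ := hB.exists_initial
    obtain ⟨T, ⟨i⟩, ⟨j⟩⟩ := e.exists_obj (e.functor.obj X).1 I
    obtain ⟨l, hl, -⟩ := e.exists_map_eq (X := T) (Y := X) i.hom (j.hom ≫ hI.some.to _)
    exact ⟨T, l, initialObjects_of_iso j.symm hI, by rw [hl]; infer_instance, fun h' => (h h').elim⟩

variable (e) in
lemma exists_freePart (hA : IsBiQuasiPointed A) (X : C) :
    ∃ (F : C) (r : X ⟶ F), e.free F ∧ IsIso (e.functor.map r).2 ∧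
      (e.free X → ∃ h : X = F, r = eqToHom h) := by
  by_cases h : e.free X
  · exact ⟨X, 𝟙 X, h, by rw [map_id_snd]; infer_instance, fun _ => ⟨rfl, rfl⟩⟩
  · obtain ⟨J, hJ⟩ := hA.exists_terminal
    obtain ⟨F, ⟨i⟩, ⟨j⟩⟩ := e.exists_obj J (e.functor.obj X).2
    obtain ⟨r, -, hr⟩ := e.exists_map_eq (X := X) (Y := F) (hJ.some.from _ ≫ i.inv) j.inv
    exact ⟨F, r, terminalObjects_of_iso i.symm hJ, by rw [hr]; infer_instance,
      fun h' => (h h').elim⟩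

variable (e) in
/-- The pretorsion theory induced by an equivalence with a product of bi-quasi-pointed
categories. -/
noncomputable def pretorsionTheory (hA : IsBiQuasiPointed A) (hB : IsBiQuasiPointed B) :
    PretorsionTheory C where
  tors := e.tors
  free := e.free
  tors_iso := ⟨fun i h => tors_of_iso i h⟩
  free_iso := ⟨fun i h => free_of_iso i h⟩
  null_of_tors_of_free f hX hY := isNull_of_tors_of_free hA hB f hX hY
  torsPart X := (e.exists_torsPart hB X).choose
  freePart X := (e.exists_freePart hA X).choose
  tors_torsPart X := (e.exists_torsPart hB X).choose_spec.choose_spec.1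
  free_freePart X := (e.exists_freePart hA X).choose_spec.choose_spec.1
  ℓ X := (e.exists_torsPart hB X).choose_spec.choose
  r X := (e.exists_freePart hA X).choose_spec.choose
  exact X := isShortExact_of_isIso hA hB (e.exists_torsPart hB X).choose_spec.choose_spec.1
    (e.exists_freePart hA X).choose_spec.choose_spec.1
    (e.exists_torsPart hB X).choose_spec.choose_spec.2.1
    (e.exists_freePart hA X).choose_spec.choose_spec.2.1
  ℓ_of_tors X := (e.exists_torsPart hB X).choose_spec.choose_spec.2.2
  r_of_free X := (e.exists_freePart hA X).choose_spec.choose_spec.2.2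

lemma isIso_map_ℓ_fst (hA : IsBiQuasiPointed A) (hB : IsBiQuasiPointed B) (X : C) :
    IsIso (e.functor.map ((e.pretorsionTheory hA hB).ℓ X)).1 :=
  (e.exists_torsPart hB X).choose_spec.choose_spec.2.1

lemma isIso_map_r_snd (hA : IsBiQuasiPointed A) (hB : IsBiQuasiPointed B) (X : C) :
    IsIso (e.functor.map ((e.pretorsionTheory hA hB).r X)).2 :=
  (e.exists_freePart hA X).choose_spec.choose_spec.2.1

/-- Short exact sequences on `X` with torsion left end and torsion-free right end are unique up to
isomorphism, so it suffices that the chosen one has the stated property. -/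
lemma isShortExact_iff (hA : IsBiQuasiPointed A) (hB : IsBiQuasiPointed B)
    {T X F : C} {l : T ⟶ X} {r : X ⟶ F} (hT : e.tors T) (hF : e.free F) :
    IsShortExact (e.tors ⊓ e.free) l r ↔
      IsIso (e.functor.map l).1 ∧ IsIso (e.functor.map r).2 := by
  refine ⟨fun h => ?_, fun h => isShortExact_of_isIso hA hB hT hF h.1 h.2⟩
  obtain ⟨i, j, rfl, rfl⟩ := (e.pretorsionTheory hA hB).exists_iso_of_isShortExact h hT hF
  have := e.isIso_map_ℓ_fst hA hB X
  have := e.isIso_map_r_snd hA hB X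
  have := ((e.isIso_iff i.hom).1 inferInstance).1
  have := ((e.isIso_iff j.hom).1 inferInstance).2
  rw [map_comp_fst, map_comp_snd]
  exact ⟨inferInstance, inferInstance⟩

/-- The torsion part of `X` retains its first component and the torsion-free part its second; their
other components are initial and terminal and carry no information. The functor is thus the given
equivalence with a product in disguise. -/
lemma isRectangular_pretorsionTheory (hA : IsBiQuasiPointed A) (hB : IsBiQuasiPointed B) :
    (e.pretorsionTheory hA hB).IsRectangular := by
  set P := e.pretorsionTheory hA hB with hP
  have hl (X : C) : IsIso (e.functor.map (P.ℓ X)).1 := e.isIso_map_ℓ_fst hA hB X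
  have hr (X : C) : IsIso (e.functor.map (P.r X)).2 := e.isIso_map_r_snd hA hB X
  refine { faithful := ⟨fun {X Y} f g h => ?_⟩, full := ⟨fun {X Y} k => ?_⟩,
           essSurj := ⟨fun K => ?_⟩ }
  · have h₁ : P.torsMap f = P.torsMap g := congrArg (fun k => k.1.hom) h
    have h₂ : P.freeMap f = P.freeMap g := congrArg (fun k => k.2.hom) h
    refine hom_ext_prod (e := e) ?_ ?_
    · rw [← cancel_epi (e.functor.map (P.ℓ X)).1, ← map_comp_fst, ← map_comp_fst, ← P.torsMap_ℓ,
        ← P.torsMap_ℓ, h₁]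
    · rw [← cancel_mono (e.functor.map (P.r Y)).2, ← map_comp_snd, ← map_comp_snd, ← P.r_freeMap,
        ← P.r_freeMap, h₂]
  · let k₁ : P.torsPart X ⟶ P.torsPart Y := k.1.hom
    let k₂ : P.freePart X ⟶ P.freePart Y := k.2.hom
    obtain ⟨f, hf₁, hf₂⟩ := e.exists_map_eq (X := X) (Y := Y)
      (inv (e.functor.map (P.ℓ X)).1 ≫ (e.functor.map (k₁ ≫ P.ℓ Y)).1)
      ((e.functor.map (P.r X ≫ k₂)).2 ≫ inv (e.functor.map (P.r Y)).2)
    refine ⟨f, Prod.ext (ObjectProperty.hom_ext _ ?_) (ObjectProperty.hom_ext _ ?_)⟩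
    · change P.torsMap f = k₁
      rw [← cancel_mono (P.ℓ Y), P.torsMap_ℓ]
      refine hom_ext_prod (e := e) ?_ ((P.tors_torsPart X : e.tors _).some.hom_ext _ _)
      rw [map_comp_fst, hf₁, IsIso.hom_inv_id_assoc]
    · change P.freeMap f = k₂
      rw [← cancel_epi (P.r X), P.r_freeMap]
      refine hom_ext_prod (e := e) ((P.free_freePart Y : e.free _).some.hom_ext _ _) ?_
      rw [map_comp_snd, hf₂, Category.assoc, IsIso.inv_hom_id, Category.comp_id]
  · have hT : e.tors K.1.obj := K.1.property
    have hF : e.free K.2.obj := K.2.property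
    -- The preimage takes its first component from the torsion object and its second from the
    -- torsion-free one.
    obtain ⟨X, ⟨i⟩, ⟨j⟩⟩ := e.exists_obj (e.functor.obj K.1.obj).1 (e.functor.obj K.2.obj).2
    have hTX : e.tors (P.torsPart X) := P.tors_torsPart X
    have hFX : e.free (P.freePart X) := P.free_freePart X
    obtain ⟨f, hf₁, -⟩ := e.exists_map_eq (X := P.torsPart X) (Y := K.1.obj)
      ((e.functor.map (P.ℓ X)).1 ≫ i.hom) (hTX.some.to _)
    obtain ⟨g, -, hg₂⟩ := e.exists_map_eq (X := P.freePart X) (Y := K.2.obj)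
      (hF.some.from _) (inv (e.functor.map (P.r X)).2 ≫ j.hom)
    have : IsIso f := (e.isIso_iff f).2
      ⟨by rw [hf₁]; infer_instance, isIso_of_initialObjects hTX hT _⟩
    have : IsIso g := (e.isIso_iff g).2
      ⟨isIso_of_terminalObjects hFX hF _, by rw [hg₂]; infer_instance⟩
    let i' : P.torsPart X ≅ K.1.obj := asIso f
    let j' : P.freePart X ≅ K.2.obj := asIso g
    exact ⟨X, ⟨Iso.prod (P.tors.isoMk i') (P.free.isoMk j')⟩⟩

end CategoryTheory.Equivalence

lemma isSymmetrical_pretorsionTheory {A B : Type u} [Category.{v} A] [Category.{v} B]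
    (e : C ≌ A × B) (hA : IsBiQuasiPointed A) (hB : IsBiQuasiPointed B) :
    (e.pretorsionTheory hA hB).IsSymmetrical :=
  ⟨A, B, _, _, hA, hB, e,
    { functor_tors := fun _ h => ⟨trivial, h⟩
      functor_free := fun _ h => ⟨h, trivial⟩
      inverse_tors := fun X h => initialObjects_of_iso
        ((CategoryTheory.Prod.snd A B).mapIso (e.counitIso.app X).symm) h.2
      inverse_free := fun X h => terminalObjects_of_iso
        ((CategoryTheory.Prod.fst A B).mapIso (e.counitIso.app X).symm) h.1 }⟩

/-- Preservation in both directions gives the equality only up to the unit of `e`; repleteness of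
the torsion objects closes the gap. -/
lemma IsPretorsionEquivalence.tors_eq {P : PretorsionTheory C} {e : C ≌ A × B}
    (h : IsPretorsionEquivalence e P.tors P.free
      (prodObjects ⊤ (initialObjects B)) (prodObjects (terminalObjects A) ⊤)) :
    P.tors = e.tors := by
  have := P.tors_iso
  funext X
  exact propext ⟨fun hX => (h.functor_tors X hX).2, fun hX =>
    P.tors.prop_of_iso (e.unitIso.app X).symm (h.inverse_tors (e.functor.obj X) ⟨trivial, hX⟩)⟩

lemma IsPretorsionEquivalence.free_eq {P : PretorsionTheory C} {e : C ≌ A × B}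
    (h : IsPretorsionEquivalence e P.tors P.free
      (prodObjects ⊤ (initialObjects B)) (prodObjects (terminalObjects A) ⊤)) :
    P.free = e.free := by
  have := P.free_iso
  funext X
  exact propext ⟨fun hX => (h.functor_free X hX).1, fun hX =>
    P.free.prop_of_iso (e.unitIso.app X).symm (h.inverse_free (e.functor.obj X) ⟨hX, trivial⟩)⟩

end ProductTheory

/-! ### Rectangular bands up to isomorphism and their decomposition -/

section Band

/-- A pseudo-algebra structure for the square monad on a category, in terms of components and
without the coherence between the associativity isomorphisms. -/
structure RectBand (C : Type u) [Category.{v} C] where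
  obj : C → C → C
  map {X X' Y Y' : C} (f : X ⟶ X') (g : Y ⟶ Y') : obj X Y ⟶ obj X' Y'
  map_id (X Y : C) : map (𝟙 X) (𝟙 Y) = 𝟙 (obj X Y)
  map_comp {X X' X'' Y Y' Y'' : C} (f : X ⟶ X') (f' : X' ⟶ X'') (g : Y ⟶ Y') (g' : Y' ⟶ Y'') :
    map (f ≫ f') (g ≫ g') = map f g ≫ map f' g'
  α (X Y Z W : C) : obj (obj X Y) (obj Z W) ≅ obj X W
  α_naturality {X Y Z W X' Y' Z' W' : C} (f : X ⟶ X') (g : Y ⟶ Y') (h : Z ⟶ Z') (k : W ⟶ W') :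
    map (map f g) (map h k) ≫ (α X' Y' Z' W').hom = (α X Y Z W).hom ≫ map f k
  υ (X : C) : X ≅ obj X X
  υ_naturality {X Y : C} (f : X ⟶ Y) : f ≫ (υ Y).hom = (υ X).hom ≫ map f f
  υ_α (X Y : C) : (υ (obj X Y)).hom ≫ (α X Y X Y).hom = 𝟙 _
  map_υ_α (X Y : C) : map (υ X).hom (υ Y).hom ≫ (α X X Y Y).hom = 𝟙 _

namespace RectBand

variable {C : Type u} [Category.{v} C] {D : Type u₁} [Category.{v₁} D]
  {A : Type u₂} [Category.{v₂} A] {B : Type u₃} [Category.{v₃} B] (R : RectBand C)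

/-- The band with the arguments exchanged. -/
@[simps obj map α υ]
def swap : RectBand C where
  obj X Y := R.obj Y X
  map f g := R.map g f
  map_id X Y := R.map_id Y X
  map_comp f f' g g' := R.map_comp g g' f f'
  α X Y Z W := R.α W Z Y X
  α_naturality f g h k := R.α_naturality k h g f
  υ := R.υ
  υ_naturality := R.υ_naturality
  υ_α X Y := R.υ_α Y X
  map_υ_α X Y := R.map_υ_α Y X

lemma map_comp_left {X X' X'' Y : C} (f : X ⟶ X') (f' : X' ⟶ X'') :
    R.map (f ≫ f') (𝟙 Y) = R.map f (𝟙 Y) ≫ R.map f' (𝟙 Y) := by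
  rw [← R.map_comp, Category.comp_id]

lemma map_comp_right {X Y Y' Y'' : C} (f : Y ⟶ Y') (f' : Y' ⟶ Y'') :
    R.map (𝟙 X) (f ≫ f') = R.map (𝟙 X) f ≫ R.map (𝟙 X) f' := by
  rw [← R.map_comp, Category.comp_id]

lemma map_eq {X X' Y Y' : C} (f : X ⟶ X') (g : Y ⟶ Y') :
    R.map f g = R.map f (𝟙 Y) ≫ R.map (𝟙 X') g := by
  rw [← R.map_comp, Category.comp_id, Category.id_comp]

lemma map_eq' {X X' Y Y' : C} (f : X ⟶ X') (g : Y ⟶ Y') :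
    R.map f g = R.map (𝟙 X) g ≫ R.map f (𝟙 Y') := by
  rw [← R.map_comp, Category.comp_id, Category.id_comp]

instance {X X' Y Y' : C} (f : X ⟶ X') (g : Y ⟶ Y') [IsIso f] [IsIso g] : IsIso (R.map f g) :=
  ⟨R.map (inv f) (inv g), by simp [← R.map_comp, R.map_id], by simp [← R.map_comp, R.map_id]⟩

/-- A functor is left if it inverts the morphisms induced by morphisms in the second variable. -/
class IsLeft (s : C ⥤ D) : Prop where
  isIso (X : C) {Y Y' : C} (g : Y ⟶ Y') : IsIso (s.map (R.map (𝟙 X) g))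

attribute [instance] IsLeft.isIso

section Left

variable (s : C ⥤ D) [R.IsLeft s] {J : C} (hJ : Limits.IsTerminal J)

/-- The canonical comparison for a left functor. -/
noncomputable def leftHom (X Y : C) : s.obj (R.obj X Y) ⟶ s.obj X :=
  s.map (R.map (𝟙 X) (hJ.from Y)) ≫ inv (s.map (R.map (𝟙 X) (hJ.from X))) ≫ s.map (R.υ X).inv

instance (X Y : C) : IsIso (R.leftHom s hJ X Y) := by
  unfold leftHom; infer_instance

/-- The canonical comparison for a left functor, as an isomorphism. -/
noncomputable def leftIso (X Y : C) : s.obj (R.obj X Y) ≅ s.obj X := asIso (R.leftHom s hJ X Y)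

lemma υ_leftHom (X : C) : s.map (R.υ X).hom ≫ R.leftHom s hJ X X = 𝟙 _ := by
  simp [leftHom, ← s.map_comp]

/-- A characterisation free of inverses: `X·Y` and `X` are compared inside `s(X·J)`, to which both
map canonically because `J` is terminal. -/
lemma leftHom_eq_iff {X Y : C} (f : s.obj (R.obj X Y) ⟶ s.obj X) :
    f = R.leftHom s hJ X Y ↔ f ≫ s.map (R.υ X).hom ≫ s.map (R.map (𝟙 X) (hJ.from X)) =
      s.map (R.map (𝟙 X) (hJ.from Y)) := by
  rw [← cancel_mono (s.map (R.υ X).hom ≫ s.map (R.map (𝟙 X) (hJ.from X)))]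
  simp [leftHom, ← s.map_comp_assoc]

lemma leftHom_υ {X Y : C} :
    R.leftHom s hJ X Y ≫ s.map (R.υ X).hom ≫ s.map (R.map (𝟙 X) (hJ.from X)) =
      s.map (R.map (𝟙 X) (hJ.from Y)) :=
  (R.leftHom_eq_iff s hJ _).1 rfl

lemma map_leftHom {X X' Y Y' : C} (f : X ⟶ X') (g : Y ⟶ Y') :
    s.map (R.map f g) ≫ R.leftHom s hJ X' Y' = R.leftHom s hJ X Y ≫ s.map f := by
  rw [← cancel_mono (s.map (R.υ X').hom ≫ s.map (R.map (𝟙 X') (hJ.from X'))), Category.assoc,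
    leftHom_υ, Category.assoc, ← s.map_comp_assoc f, R.υ_naturality, s.map_comp, Category.assoc,
    ← s.map_comp, ← s.map_comp, ← R.map_comp, ← R.map_comp, Category.comp_id,
    hJ.hom_ext (f ≫ hJ.from X') (hJ.from X), hJ.hom_ext (g ≫ hJ.from Y') (hJ.from Y)]
  have (Z : C) : R.map f (hJ.from Z) = R.map (𝟙 X) (hJ.from Z) ≫ R.map f (𝟙 J) := R.map_eq' _ _
  rw [this X, this Y, s.map_comp, s.map_comp, ← R.leftHom_υ s hJ]
  simp only [Category.assoc]

/-- Naturality in the second variable moves `ω X Y` first to `ω X J` and from there back to `ω X X`,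
where the unit condition fixes it. -/
lemma eq_leftHom (ω : ∀ X Y, s.obj (R.obj X Y) ⟶ s.obj X)
    (hω : ∀ (X : C) {Y Y' : C} (g : Y ⟶ Y'), s.map (R.map (𝟙 X) g) ≫ ω X Y' = ω X Y)
    (hω' : ∀ X, s.map (R.υ X).hom ≫ ω X X = 𝟙 _) (X Y : C) : ω X Y = R.leftHom s hJ X Y := by
  rw [← hω X (hJ.from Y), ← R.leftHom_υ s hJ, Category.assoc, Category.assoc, hω, hω',
    Category.comp_id]

/-- Both sides are natural in all four variables and depend only on the first through `s`. They
agree on the diagonal by the unit law `υ_α`, and the maps `(X, X, X, X) ⟶ (X, J, J, J) ⟵ (X, Y, Z,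
W)` spread the equality to all arguments. No coherence of `α` with itself is needed. -/
lemma α_leftHom (X Y Z W : C) : s.map (R.α X Y Z W).hom ≫ R.leftHom s hJ X W =
    R.leftHom s hJ (R.obj X Y) (R.obj Z W) ≫ R.leftHom s hJ X Y := by
  have nat₁ {X Y Z W X' Y' Z' W' : C} (f : X ⟶ X') (g : Y ⟶ Y') (h : Z ⟶ Z') (k : W ⟶ W') :
      s.map (R.map (R.map f g) (R.map h k)) ≫ s.map (R.α X' Y' Z' W').hom ≫
        R.leftHom s hJ X' W' = (s.map (R.α X Y Z W).hom ≫ R.leftHom s hJ X W) ≫ s.map f := by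
    rw [← s.map_comp_assoc, R.α_naturality, s.map_comp, Category.assoc, map_leftHom,
      Category.assoc]
  have nat₂ {X Y Z W X' Y' Z' W' : C} (f : X ⟶ X') (g : Y ⟶ Y') (h : Z ⟶ Z') (k : W ⟶ W') :
      s.map (R.map (R.map f g) (R.map h k)) ≫ R.leftHom s hJ (R.obj X' Y') (R.obj Z' W') ≫
        R.leftHom s hJ X' Y' =
      (R.leftHom s hJ (R.obj X Y) (R.obj Z W) ≫ R.leftHom s hJ X Y) ≫ s.map f := by
    rw [← Category.assoc, map_leftHom, Category.assoc, map_leftHom, Category.assoc]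
  have diag : s.map (R.α X X X X).hom ≫ R.leftHom s hJ X X =
      R.leftHom s hJ (R.obj X X) (R.obj X X) ≫ R.leftHom s hJ X X := by
    rw [← cancel_epi (s.map (R.υ (R.obj X X)).hom), ← s.map_comp_assoc, R.υ_α, ← Category.assoc,
      υ_leftHom, s.map_id]
  have key : s.map (R.α X J J J).hom ≫ R.leftHom s hJ X J =
      R.leftHom s hJ (R.obj X J) (R.obj J J) ≫ R.leftHom s hJ X J := by
    have h₁ := nat₁ (𝟙 X) (hJ.from X) (hJ.from X) (hJ.from X)
    have h₂ := nat₂ (𝟙 X) (hJ.from X) (hJ.from X) (hJ.from X)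
    -- By `h₂` this image becomes invertible after composition with an invertible comparison, so the
    -- diagonal identity can be transported forwards along it.
    have : IsIso (s.map (R.map (R.map (𝟙 X) (hJ.from X)) (R.map (hJ.from X) (hJ.from X)))) := by
      have : IsIso (s.map (R.map (R.map (𝟙 X) (hJ.from X)) (R.map (hJ.from X) (hJ.from X))) ≫
          R.leftHom s hJ (R.obj X J) (R.obj J J) ≫ R.leftHom s hJ X J) := by
        rw [h₂]; infer_instance
      exact IsIso.of_isIso_comp_right _
        (R.leftHom s hJ (R.obj X J) (R.obj J J) ≫ R.leftHom s hJ X J)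
    rw [← cancel_epi (s.map (R.map (R.map (𝟙 X) (hJ.from X)) (R.map (hJ.from X) (hJ.from X)))),
      h₁, h₂, diag]
  have h₁ := nat₁ (𝟙 X) (hJ.from Y) (hJ.from Z) (hJ.from W)
  have h₂ := nat₂ (𝟙 X) (hJ.from Y) (hJ.from Z) (hJ.from W)
  rw [s.map_id, Category.comp_id] at h₁ h₂
  rw [← h₁, ← h₂, key]

/-- The comparison is natural in the left functor too; applied to whiskered 2-cells, this is what
makes every natural transformation compatible with band structures. -/
lemma leftHom_app {s s' : C ⥤ D} [R.IsLeft s] [R.IsLeft s'] (τ : s ⟶ s') (X Y : C) :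
    τ.app (R.obj X Y) ≫ R.leftHom s' hJ X Y = R.leftHom s hJ X Y ≫ τ.app X := by
  rw [← cancel_mono (s'.map (R.υ X).hom ≫ s'.map (R.map (𝟙 X) (hJ.from X))), Category.assoc,
    leftHom_υ, Category.assoc, ← τ.naturality_assoc,
    ← τ.naturality (R.map (𝟙 X) (hJ.from X)), ← τ.naturality, ← R.leftHom_υ s hJ, Category.assoc,
    Category.assoc]

end Left

/-- A functor inverts the morphisms which are inverted by a left functor belonging to a jointly
conservative pair of a left and a right functor. -/
lemma IsLeft.isIso_map {J : C} (hJ : Limits.IsTerminal J) (p : C ⥤ A) (q : C ⥤ B) [R.IsLeft p]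
    [R.swap.IsLeft q]
    (hpq : ∀ {X Y : C} (f : X ⟶ Y), IsIso (p.map f) → IsIso (q.map f) → IsIso f) (s : C ⥤ D)
    [R.IsLeft s] {X Y : C} (f : X ⟶ Y) (hf : IsIso (p.map f)) : IsIso (s.map f) := by
  -- The right functor `q` inverts `f·X` regardless of `f`, while `p(f·X)` is isomorphic to `p(f)`
  -- through the comparison.
  have h₁ : IsIso (R.map f (𝟙 X)) := by
    refine hpq _ ?_ (IsLeft.isIso (R := R.swap) (s := q) X f)
    have : IsIso (p.map (R.map f (𝟙 X)) ≫ R.leftHom p hJ Y X) := by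
      rw [map_leftHom]; infer_instance
    exact IsIso.of_isIso_comp_right _ (R.leftHom p hJ Y X)
  -- Factor `f·f` as `f·X` followed by `Y·f`: the former is invertible by `h₁`, the latter is
  -- inverted by `s`. Naturality of `υ` then passes from `f·f` to `f`.
  have h₂ : IsIso (s.map (R.map f f)) := by
    rw [R.map_eq, s.map_comp]; infer_instance
  have h₃ : IsIso (s.map f ≫ s.map (R.υ Y).hom) := by
    rw [← s.map_comp, R.υ_naturality, s.map_comp]; infer_instance
  exact IsIso.of_isIso_comp_right _ (s.map (R.υ Y).hom)

/-- The functor fixing the second argument. -/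
@[simps]
def fixRight (U : C) : C ⥤ C where
  obj X := R.obj X U
  map f := R.map f (𝟙 U)
  map_id X := R.map_id X U
  map_comp f g := R.map_comp_left f g

/-- The absorption isomorphism for the functor fixing the second argument. -/
@[simps!]
noncomputable def absorb (U X Y : C) : R.obj (R.obj X Y) U ≅ R.obj X U :=
  asIso (R.map (𝟙 (R.obj X Y)) (R.υ U).hom) ≪≫ R.α X Y U U

lemma map_absorb (U : C) {X X' Y Y' : C} (f : X ⟶ X') (g : Y ⟶ Y') :
    R.map (R.map f g) (𝟙 U) ≫ (R.absorb U X' Y').hom =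
      (R.absorb U X Y).hom ≫ R.map f (𝟙 U) := by
  simp only [absorb_hom]
  rw [Category.assoc, ← R.α_naturality f g (𝟙 U) (𝟙 U), ← Category.assoc, ← Category.assoc,
    ← R.map_comp, ← R.map_comp, R.map_id]
  simp

lemma υ_absorb (U X : C) : R.map (R.υ X).hom (𝟙 U) ≫ (R.absorb U X X).hom = 𝟙 _ := by
  simp only [absorb_hom]
  rw [← Category.assoc, ← R.map_comp, Category.comp_id, Category.id_comp, R.map_υ_α]

/-- By `map_absorb`, the map `(X·g)·U` is one absorption isomorphism followed by the inverse of
another. -/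
instance (U : C) : R.IsLeft (R.fixRight U) where
  isIso X Y Y' g := by
    have h := R.map_absorb U (𝟙 X) g
    rw [R.map_id, Category.comp_id] at h
    rw [← Iso.eq_comp_inv] at h
    change IsIso (R.map (R.map (𝟙 X) g) (𝟙 U))
    rw [h]; infer_instance

lemma absorb_eq_leftHom {J : C} (hJ : Limits.IsTerminal J) (U X Y : C) :
    (R.absorb U X Y).hom = R.leftHom (R.fixRight U) hJ X Y :=
  R.eq_leftHom (R.fixRight U) hJ (fun X Y => (R.absorb U X Y).hom)
    (fun X Y Y' g => by
      have h := R.map_absorb U (𝟙 X) g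
      rwa [R.map_id, Category.comp_id] at h)
    (fun X => R.υ_absorb U X) X Y

/-- Absorption is natural and unital, hence equals the canonical comparison of the left functor
`R.fixRight U`; its compatibility with `α` is then an instance of `α_leftHom`. -/
lemma α_absorb {J : C} (hJ : Limits.IsTerminal J) (U X Y Z W : C) :
    R.map (R.α X Y Z W).hom (𝟙 U) ≫ (R.absorb U X W).hom =
      (R.absorb U (R.obj X Y) (R.obj Z W)).hom ≫ (R.absorb U X Y).hom := by
  rw [R.absorb_eq_leftHom hJ, R.absorb_eq_leftHom hJ, R.absorb_eq_leftHom hJ]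
  exact R.α_leftHom (R.fixRight U) hJ X Y Z W

/-- Rewrites `(X·U)·U ⟶ X·U` so that it refers to the object `X·U` alone and no longer to `X`.
Initiality of `U` splits the map `U ⟶ X·U` into `υ` followed by `(U ⟶ X)·U`, and `υ_α` identifies
the inverse of `υ` at `X·U` with `α`. -/
lemma absorb_self {U : C} (hU : Limits.IsInitial U) (X : C) :
    (R.absorb U X U).hom = R.map (𝟙 (R.obj X U)) (hU.to _) ≫ (R.υ (R.obj X U)).inv := by
  rw [hU.hom_ext (hU.to (R.obj X U)) ((R.υ U).hom ≫ R.map (hU.to X) (𝟙 U)), R.map_comp_right,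
    Category.assoc, absorb_hom]
  congr 1
  have hυ : (R.υ (R.obj X U)).inv = (R.α X U X U).hom := by
    rw [← Category.comp_id (R.υ (R.obj X U)).inv, Iso.inv_comp_eq, R.υ_α]
  have h := R.α_naturality (𝟙 X) (𝟙 U) (hU.to X) (𝟙 U)
  rw [R.map_id, Category.comp_id] at h
  rw [hυ, h]

/-- The morphism `k` is arbitrary and need not have the form `f·U`; this is where `U` must be
initial, and it is the heart of fullness in `isEquivalence_prod'`. -/
lemma absorb_naturality {U : C} (hU : Limits.IsInitial U) {X Y : C}
    (k : R.obj X U ⟶ R.obj Y U) :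
    R.map k (𝟙 U) ≫ (R.absorb U Y U).hom = (R.absorb U X U).hom ≫ k := by
  rw [R.absorb_self hU, R.absorb_self hU, Category.assoc, ← cancel_mono (R.υ (R.obj Y U)).hom]
  simp only [Category.assoc, Iso.inv_hom_id, Category.comp_id]
  rw [R.υ_naturality, Iso.inv_hom_id_assoc, ← R.map_comp, ← R.map_comp]
  congr 1
  · simp
  · exact hU.hom_ext _ _

/-- The pair `f·U`, `U·f` determines `(f·U)·(U·f)`, which `α` identifies with `f·f` and `υ` with
`f`. -/
lemma hom_ext_of_fix {U X Y : C} {f g : X ⟶ Y} (h₁ : R.map f (𝟙 U) = R.map g (𝟙 U))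
    (h₂ : R.map (𝟙 U) f = R.map (𝟙 U) g) : f = g := by
  rw [← cancel_mono (R.υ Y).hom, R.υ_naturality, R.υ_naturality]
  congr 1
  rw [← cancel_epi (R.α X U U X).hom, ← R.α_naturality f (𝟙 U) (𝟙 U) f,
    ← R.α_naturality g (𝟙 U) (𝟙 U) g, h₁, h₂]

/-- The morphism with given components. -/
def glue (U : C) {X Y : C} (k : R.obj X U ⟶ R.obj Y U) (l : R.obj U X ⟶ R.obj U Y) : X ⟶ Y :=
  (R.υ X).hom ≫ (R.α X U U X).inv ≫ R.map k l ≫ (R.α Y U U Y).hom ≫ (R.υ Y).inv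

/-- After applying `-·U`, the structure isomorphisms in `glue` all become absorptions and cancel,
leaving `k·U` conjugated by absorption, which is `k` by `absorb_naturality`. The second component
`l` disappears because absorption discards the second argument. -/
lemma map_glue {J : C} (hJ : Limits.IsTerminal J) {U : C} (hU : Limits.IsInitial U) {X Y : C}
    (k : R.obj X U ⟶ R.obj Y U) (l : R.obj U X ⟶ R.obj U Y) :
    R.map (R.glue U k l) (𝟙 U) = k := by
  have h₁ : R.map (R.υ X).hom (𝟙 U) = (R.absorb U X X).inv := by
    rw [← cancel_mono (R.absorb U X X).hom, R.υ_absorb, Iso.inv_hom_id]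
  have h₂ : R.map (R.υ Y).inv (𝟙 U) = (R.absorb U Y Y).hom := by
    rw [← cancel_epi (R.map (R.υ Y).hom (𝟙 U)), R.υ_absorb, ← R.map_comp_left, Iso.hom_inv_id,
      R.map_id]
  have h₃ : (R.absorb U X X).inv ≫ R.map (R.α X U U X).inv (𝟙 U) =
      (R.absorb U X U).inv ≫ (R.absorb U (R.obj X U) (R.obj U X)).inv := by
    rw [Iso.inv_comp_eq, ← cancel_epi (R.map (R.α X U U X).hom (𝟙 U)), ← R.map_comp_left,
      Iso.hom_inv_id, R.map_id, ← Category.assoc, R.α_absorb hJ]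
    simp
  unfold glue
  simp only [R.map_comp_left]
  rw [h₁, h₂, R.α_absorb hJ, ← Category.assoc, h₃]
  simp only [Category.assoc]
  rw [← Category.assoc (R.map (R.map k l) (𝟙 U)), R.map_absorb]
  simp only [Category.assoc, Iso.inv_hom_id_assoc]
  rw [R.absorb_naturality hU, Iso.inv_hom_id_assoc]

/-- The category of left components. -/
abbrev LeftPart (U : C) : Type u := InducedCategory C (fun X => R.obj X U)

/-- The projection to the left components. -/
def toLeftPart (U : C) : C ⥤ R.LeftPart U where
  obj X := X
  map f := InducedCategory.homMk (R.map f (𝟙 U))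
  map_id X := InducedCategory.hom_ext (R.map_id X U)
  map_comp f g := InducedCategory.hom_ext (R.map_comp_left f g)

instance (U : C) : R.IsLeft (R.toLeftPart U) where
  isIso X Y Y' g := by
    have : IsIso ((inducedFunctor _).map ((R.toLeftPart U).map (R.map (𝟙 X) g))) :=
      IsLeft.isIso (R := R) (s := R.fixRight U) X g
    exact isIso_of_reflects_iso _ (inducedFunctor (fun X => R.obj X U))

/-- Faithfulness says that a morphism is determined by its two components, fullness that `glue` has
prescribed components, and essential surjectivity that `K.1·K.2` absorbs to `K.1` on the left and to
`K.2` on the right. -/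
lemma isEquivalence_prod' {J U : C} (hJ : Limits.IsTerminal J) (hU : Limits.IsInitial U) :
    ((R.toLeftPart U).prod' (R.swap.toLeftPart U)).IsEquivalence where
  faithful := ⟨fun h => R.hom_ext_of_fix (U := U)
    (congrArg (fun k => k.1.hom) h) (congrArg (fun k => k.2.hom) h)⟩
  full := ⟨fun k => ⟨R.glue U k.1.hom k.2.hom,
    Prod.ext (InducedCategory.hom_ext (R.map_glue hJ hU k.1.hom k.2.hom))
      (InducedCategory.hom_ext (R.swap.map_glue hJ hU k.2.hom k.1.hom))⟩⟩
  essSurj := ⟨fun K => ⟨R.obj K.1 K.2, ⟨Iso.prod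
    (InducedCategory.isoMk (R.absorb U K.1 K.2))
    (InducedCategory.isoMk (R.swap.absorb U K.2 K.1))⟩⟩⟩

/-- An equivalence with a product splits a band if its components are left and right. -/
class Splits (e : C ≌ A × B) : Prop where
  left : R.IsLeft (e.functor ⋙ CategoryTheory.Prod.fst A B)
  right : R.swap.IsLeft (e.functor ⋙ CategoryTheory.Prod.snd A B)

attribute [instance] Splits.left Splits.right

lemma exists_splits (hC : IsBiQuasiPointed C) :
    ∃ (A B : Type u) (_ : Category.{v} A) (_ : Category.{v} B),
      IsBiQuasiPointed A ∧ IsBiQuasiPointed B ∧ ∃ e : C ≌ A × B, R.Splits e := by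
  obtain ⟨U, ⟨hU⟩⟩ := hC.exists_initial
  obtain ⟨J, ⟨hJ⟩⟩ := hC.exists_terminal
  have := R.isEquivalence_prod' hJ hU
  let e := ((R.toLeftPart U).prod' (R.swap.toLeftPart U)).asEquivalence
  have h := hC.of_equivalence e.symm
  exact ⟨_, _, _, _, h.fst_of_prod, h.snd_of_prod, e,
    ⟨inferInstanceAs (R.IsLeft (R.toLeftPart U)),
      inferInstanceAs (R.swap.IsLeft (R.swap.toLeftPart U))⟩⟩

end RectBand

end Band

/-! ### Morphisms of bands: uniqueness and existence -/

section BandHom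

namespace RectBand

variable {C : Type u} [Category.{v} C] {D : Type u₁} [Category.{v₁} D]
  {A : Type u₂} [Category.{v₂} A] {B : Type u₃} [Category.{v₃} B]

/-- The structure of a pseudo-morphism on a functor, in terms of components. -/
structure Hom (R : RectBand C) (S : RectBand D) (G : C ⥤ D) where
  iso (X Y : C) : S.obj (G.obj X) (G.obj Y) ≅ G.obj (R.obj X Y)
  naturality {X Y X' Y' : C} (f : X ⟶ X') (g : Y ⟶ Y') :
    S.map (G.map f) (G.map g) ≫ (iso X' Y').hom = (iso X Y).hom ≫ G.map (R.map f g)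
  assoc (X Y Z W : C) : S.map (iso X Y).hom (iso Z W).hom ≫
      (iso (R.obj X Y) (R.obj Z W)).hom ≫ G.map (R.α X Y Z W).hom =
    (S.α (G.obj X) (G.obj Y) (G.obj Z) (G.obj W)).hom ≫ (iso X W).hom
  unit (X : C) : (S.υ (G.obj X)).hom ≫ (iso X X).hom = G.map (R.υ X).hom

variable {R : RectBand C} {S : RectBand D} {G H : C ⥤ D}

namespace Hom

/-- The same morphism between the bands with the arguments exchanged. -/
@[simps]
def swap (θ : Hom R S G) : Hom R.swap S.swap G where
  iso X Y := θ.iso Y X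
  naturality f g := θ.naturality g f
  assoc X Y Z W := θ.assoc W Z Y X
  unit := θ.unit

lemma isLeft_comp (θ : Hom R S G) (p : D ⥤ A) [S.IsLeft p] : R.IsLeft (G ⋙ p) where
  isIso X Y Y' g := by
    have h := θ.naturality (𝟙 X) g
    rw [G.map_id, ← Iso.inv_comp_eq] at h
    rw [Functor.comp_map, ← h, p.map_comp, p.map_comp]
    infer_instance

/-- Transporting the comparison of `S` along the inverse of the structure isomorphism gives a
natural, unital family for `G ⋙ p`; by `eq_leftHom` it is the canonical one. Thus left functors
leave no freedom in the structure isomorphism. -/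
lemma map_iso_leftHom (θ : Hom R S G) (p : D ⥤ A) [S.IsLeft p] [R.IsLeft (G ⋙ p)] {J : C}
    (hJ : Limits.IsTerminal J) {J' : D} (hJ' : Limits.IsTerminal J') (X Y : C) :
    p.map (θ.iso X Y).hom ≫ R.leftHom (G ⋙ p) hJ X Y =
      S.leftHom p hJ' (G.obj X) (G.obj Y) := by
  have h := R.eq_leftHom (G ⋙ p) hJ
    (fun X Y => p.map (θ.iso X Y).inv ≫ S.leftHom p hJ' (G.obj X) (G.obj Y)) (fun X Y Y' g => ?_)
    (fun X => ?_) X Y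
  · rw [← h, ← p.map_comp_assoc, Iso.hom_inv_id, p.map_id, Category.id_comp]
  · have h := θ.naturality (𝟙 X) g
    rw [G.map_id, ← Iso.inv_comp_eq] at h
    rw [Functor.comp_map, ← h, ← p.map_comp_assoc, Category.assoc, Category.assoc,
      Iso.hom_inv_id, Category.comp_id, p.map_comp, Category.assoc, map_leftHom, p.map_id,
      Category.comp_id]
  · rw [Functor.comp_map, ← θ.unit, p.map_comp, Category.assoc, Iso.map_hom_inv_id_assoc,
      υ_leftHom]
    rfl

lemma map_naturality (θ : Hom R S G) (θ' : Hom R S H) (τ : G ⟶ H) (p : D ⥤ A) [S.IsLeft p]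
    {J : C} (hJ : Limits.IsTerminal J) {J' : D} (hJ' : Limits.IsTerminal J') (X Y : C) :
    p.map (S.map (τ.app X) (τ.app Y) ≫ (θ'.iso X Y).hom) =
      p.map ((θ.iso X Y).hom ≫ τ.app (R.obj X Y)) := by
  have := θ.isLeft_comp p
  have := θ'.isLeft_comp p
  rw [← cancel_mono (R.leftHom (H ⋙ p) hJ X Y), p.map_comp, Category.assoc,
    θ'.map_iso_leftHom p hJ hJ', map_leftHom, ← θ.map_iso_leftHom p hJ hJ', p.map_comp,
    Category.assoc, Category.assoc]
  exact congrArg (_ ≫ ·) (R.leftHom_app hJ (Functor.whiskerRight τ p) X Y).symm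

/-- Every natural transformation is compatible with the structures of pseudo-morphisms. -/
lemma comm (hC : IsBiQuasiPointed C) (hD : IsBiQuasiPointed D) (θ : Hom R S G)
    (θ' : Hom R S H) (τ : G ⟶ H) (X Y : C) :
    S.map (τ.app X) (τ.app Y) ≫ (θ'.iso X Y).hom = (θ.iso X Y).hom ≫ τ.app (R.obj X Y) := by
  -- A splitting of the target reduces the equation to its components, the first seen by a left
  -- functor and the second by a right one, that is, a left functor for the swapped band.
  obtain ⟨A, B, _, _, -, -, e, he⟩ := S.exists_splits hD
  obtain ⟨J, ⟨hJ⟩⟩ := hC.exists_terminal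
  obtain ⟨J', ⟨hJ'⟩⟩ := hD.exists_terminal
  exact Equivalence.hom_ext_prod (e := e)
    (θ.map_naturality θ' τ (e.functor ⋙ CategoryTheory.Prod.fst A B) hJ hJ' X Y)
    (θ.swap.map_naturality θ'.swap τ (e.functor ⋙ CategoryTheory.Prod.snd A B) hJ hJ' Y X)

/-- Compatibility of the identity transformation of `G` with two structures on `G` forces them to
coincide: being a pseudo-morphism is a property of a functor. -/
lemma iso_eq (hC : IsBiQuasiPointed C) (hD : IsBiQuasiPointed D) (θ θ' : Hom R S G) (X Y : C) :
    (θ.iso X Y).hom = (θ'.iso X Y).hom := by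
  have h := comm hC hD θ θ' (𝟙 G) X Y
  simpa [S.map_id] using h.symm

section OfIsLeft

variable (R S G)
variable (e : D ≌ A × B) [S.Splits e]
  [R.IsLeft (G ⋙ e.functor ⋙ CategoryTheory.Prod.fst A B)]
  [R.swap.IsLeft (G ⋙ e.functor ⋙ CategoryTheory.Prod.snd A B)]
  {J : C} (hJ : Limits.IsTerminal J) {J' : D} (hJ' : Limits.IsTerminal J')

/-- The comparison isomorphism for a functor with left and right components. -/
noncomputable def comparison (X Y : C) : S.obj (G.obj X) (G.obj Y) ≅ G.obj (R.obj X Y) :=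
  e.functor.preimageIso (Iso.prod
    (S.leftIso (e.functor ⋙ CategoryTheory.Prod.fst A B) hJ' (G.obj X) (G.obj Y) ≪≫
      (R.leftIso (G ⋙ e.functor ⋙ CategoryTheory.Prod.fst A B) hJ X Y).symm)
    (S.swap.leftIso (e.functor ⋙ CategoryTheory.Prod.snd A B) hJ' (G.obj Y) (G.obj X) ≪≫
      (R.swap.leftIso (G ⋙ e.functor ⋙ CategoryTheory.Prod.snd A B) hJ Y X).symm))

lemma comparison_fst (X Y : C) :
    (e.functor ⋙ CategoryTheory.Prod.fst A B).map (comparison R S G e hJ hJ' X Y).hom ≫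
        R.leftHom (G ⋙ e.functor ⋙ CategoryTheory.Prod.fst A B) hJ X Y =
      S.leftHom (e.functor ⋙ CategoryTheory.Prod.fst A B) hJ' (G.obj X) (G.obj Y) :=
  (Iso.eq_comp_inv (R.leftIso (G ⋙ e.functor ⋙ CategoryTheory.Prod.fst A B) hJ X Y)).1
    (congrArg Prod.fst (e.functor.map_preimage (X := S.obj (G.obj X) (G.obj Y)) _))

lemma comparison_snd (X Y : C) :
    (e.functor ⋙ CategoryTheory.Prod.snd A B).map (comparison R S G e hJ hJ' X Y).hom ≫
        R.swap.leftHom (G ⋙ e.functor ⋙ CategoryTheory.Prod.snd A B) hJ Y X =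
      S.swap.leftHom (e.functor ⋙ CategoryTheory.Prod.snd A B) hJ' (G.obj Y) (G.obj X) :=
  (Iso.eq_comp_inv (R.swap.leftIso (G ⋙ e.functor ⋙ CategoryTheory.Prod.snd A B) hJ Y X)).1
    (congrArg Prod.snd (e.functor.map_preimage (X := S.obj (G.obj X) (G.obj Y)) _))

variable {R S G} {p : D ⥤ A} [S.IsLeft p] [R.IsLeft (G ⋙ p)]
  {c : ∀ X Y : C, S.obj (G.obj X) (G.obj Y) ⟶ G.obj (R.obj X Y)}

lemma map_naturality_of (hc : ∀ X Y, p.map (c X Y) ≫ R.leftHom (G ⋙ p) hJ X Y =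
      S.leftHom p hJ' (G.obj X) (G.obj Y)) {X Y X' Y' : C} (f : X ⟶ X') (g : Y ⟶ Y') :
    p.map (S.map (G.map f) (G.map g) ≫ c X' Y') = p.map (c X Y ≫ G.map (R.map f g)) := by
  have h := R.map_leftHom (G ⋙ p) hJ f g
  simp only [Functor.comp_map] at h
  rw [← cancel_mono (R.leftHom (G ⋙ p) hJ X' Y'), p.map_comp, Category.assoc, hc, map_leftHom,
    ← hc, p.map_comp, Category.assoc, Category.assoc, h]

/-- After composition with the comparison for `G ⋙ p`, each `c` turns into a comparison for `p` and
each `α` into two comparisons by `α_leftHom`; both sides become the same composite. -/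
lemma map_assoc_of (hc : ∀ X Y, p.map (c X Y) ≫ R.leftHom (G ⋙ p) hJ X Y =
      S.leftHom p hJ' (G.obj X) (G.obj Y)) (X Y Z W : C) :
    p.map (S.map (c X Y) (c Z W) ≫ c (R.obj X Y) (R.obj Z W) ≫ G.map (R.α X Y Z W).hom) =
      p.map ((S.α (G.obj X) (G.obj Y) (G.obj Z) (G.obj W)).hom ≫ c X W) := by
  have h := R.α_leftHom (G ⋙ p) hJ X Y Z W
  have h' := hc (R.obj X Y) (R.obj Z W)
  simp only [Functor.comp_map] at h
  rw [← cancel_mono (R.leftHom (G ⋙ p) hJ X W), p.map_comp, p.map_comp, p.map_comp,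
    Category.assoc, Category.assoc, Category.assoc, hc, h, α_leftHom,
    ← Category.assoc (p.map (c (R.obj X Y) (R.obj Z W))), h', ← Category.assoc, map_leftHom, ← hc,
    Category.assoc]

lemma map_unit_of (hc : ∀ X Y, p.map (c X Y) ≫ R.leftHom (G ⋙ p) hJ X Y =
      S.leftHom p hJ' (G.obj X) (G.obj Y)) (X : C) :
    p.map ((S.υ (G.obj X)).hom ≫ c X X) = p.map (G.map (R.υ X).hom) := by
  have h := R.υ_leftHom (G ⋙ p) hJ X
  simp only [Functor.comp_map] at h
  rw [← cancel_mono (R.leftHom (G ⋙ p) hJ X X), h, p.map_comp, Category.assoc, hc, υ_leftHom]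
  rfl

variable (R S G) in
/-- The structure of a pseudo-morphism on a functor with left and right components. -/
noncomputable def ofIsLeft : Hom R S G where
  iso := comparison R S G e hJ hJ'
  naturality f g := Equivalence.hom_ext_prod (e := e)
    (map_naturality_of hJ hJ' (comparison_fst R S G e hJ hJ') f g)
    (map_naturality_of (R := R.swap) (S := S.swap) hJ hJ'
      (fun X Y => comparison_snd R S G e hJ hJ' Y X) g f)
  assoc X Y Z W := Equivalence.hom_ext_prod (e := e)
    (map_assoc_of hJ hJ' (comparison_fst R S G e hJ hJ') X Y Z W)
    (map_assoc_of (R := R.swap) (S := S.swap) hJ hJ'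
      (fun X Y => comparison_snd R S G e hJ hJ' Y X) W Z Y X)
  unit X := Equivalence.hom_ext_prod (e := e)
    (map_unit_of hJ hJ' (comparison_fst R S G e hJ hJ') X)
    (map_unit_of (R := R.swap) (S := S.swap) hJ hJ'
      (fun X Y => comparison_snd R S G e hJ hJ' Y X) X)

end OfIsLeft

end Hom

end RectBand

end BandHom

/-! ### The band of a decomposition -/

section BandOfEquivalence

namespace CategoryTheory.Equivalence

variable {C : Type u} [Category.{v} C] {A : Type u₂} [Category.{v₂} A] {B : Type u₃}
  [Category.{v₃} B] (e : C ≌ A × B)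

/-- The object with given components. -/
def glue (X Y : C) : C := e.inverse.obj ((e.functor.obj X).1, (e.functor.obj Y).2)

/-- The morphism with given components. -/
def glueMap {X X' Y Y' : C} (f : X ⟶ X') (g : Y ⟶ Y') : e.glue X Y ⟶ e.glue X' Y' :=
  e.inverse.map (X := ((e.functor.obj X).1, (e.functor.obj Y).2))
    (Y := ((e.functor.obj X').1, (e.functor.obj Y').2))
    ((e.functor.map f).1, (e.functor.map g).2)

/-- The first component of an object with given components. -/
def glueFst (X Y : C) : (e.functor.obj (e.glue X Y)).1 ≅ (e.functor.obj X).1 :=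
  (CategoryTheory.Prod.fst A B).mapIso (X := e.functor.obj (e.glue X Y))
    (Y := ((e.functor.obj X).1, (e.functor.obj Y).2))
    (e.counitIso.app ((e.functor.obj X).1, (e.functor.obj Y).2))

/-- The second component of an object with given components. -/
def glueSnd (X Y : C) : (e.functor.obj (e.glue X Y)).2 ≅ (e.functor.obj Y).2 :=
  (CategoryTheory.Prod.snd A B).mapIso (X := e.functor.obj (e.glue X Y))
    (Y := ((e.functor.obj X).1, (e.functor.obj Y).2))
    (e.counitIso.app ((e.functor.obj X).1, (e.functor.obj Y).2))

@[simp]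
lemma glueMap_fst {X X' Y Y' : C} (f : X ⟶ X') (g : Y ⟶ Y') :
    (e.functor.map (e.glueMap f g)).1 ≫ (e.glueFst X' Y').hom =
      (e.glueFst X Y).hom ≫ (e.functor.map f).1 :=
  congrArg (fun k => k.1) (e.counitIso.hom.naturality
    (X := ((e.functor.obj X).1, (e.functor.obj Y).2))
    (Y := ((e.functor.obj X').1, (e.functor.obj Y').2))
    ((e.functor.map f).1, (e.functor.map g).2))

@[simp]
lemma glueMap_snd {X X' Y Y' : C} (f : X ⟶ X') (g : Y ⟶ Y') :
    (e.functor.map (e.glueMap f g)).2 ≫ (e.glueSnd X' Y').hom =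
      (e.glueSnd X Y).hom ≫ (e.functor.map g).2 :=
  congrArg (fun k => k.2) (e.counitIso.hom.naturality
    (X := ((e.functor.obj X).1, (e.functor.obj Y).2))
    (Y := ((e.functor.obj X').1, (e.functor.obj Y').2))
    ((e.functor.map f).1, (e.functor.map g).2))

@[simp]
lemma glueMap_fst_assoc {X X' Y Y' : C} (f : X ⟶ X') (g : Y ⟶ Y') {Z : A}
    (h : (e.functor.obj X').1 ⟶ Z) :
    (e.functor.map (e.glueMap f g)).1 ≫ (e.glueFst X' Y').hom ≫ h =
      (e.glueFst X Y).hom ≫ (e.functor.map f).1 ≫ h := by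
  rw [← Category.assoc, glueMap_fst, Category.assoc]

@[simp]
lemma glueMap_snd_assoc {X X' Y Y' : C} (f : X ⟶ X') (g : Y ⟶ Y') {Z : B}
    (h : (e.functor.obj Y').2 ⟶ Z) :
    (e.functor.map (e.glueMap f g)).2 ≫ (e.glueSnd X' Y').hom ≫ h =
      (e.glueSnd X Y).hom ≫ (e.functor.map g).2 ≫ h := by
  rw [← Category.assoc, glueMap_snd, Category.assoc]

variable {e} in
/-- The isomorphism with given components. -/
noncomputable def isoOfComponents {X Y : C} (i : (e.functor.obj X).1 ≅ (e.functor.obj Y).1)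
    (j : (e.functor.obj X).2 ≅ (e.functor.obj Y).2) : X ≅ Y :=
  e.functor.preimageIso (Iso.prod i j)

@[simp]
lemma map_isoOfComponents_fst {X Y : C} (i : (e.functor.obj X).1 ≅ (e.functor.obj Y).1)
    (j : (e.functor.obj X).2 ≅ (e.functor.obj Y).2) :
    (e.functor.map (isoOfComponents i j).hom).1 = i.hom := by
  simp [isoOfComponents]

@[simp]
lemma map_isoOfComponents_snd {X Y : C} (i : (e.functor.obj X).1 ≅ (e.functor.obj Y).1)
    (j : (e.functor.obj X).2 ≅ (e.functor.obj Y).2) :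
    (e.functor.map (isoOfComponents i j).hom).2 = j.hom := by
  simp [isoOfComponents]

lemma hom_ext_glue {W X Y : C} {f g : W ⟶ e.glue X Y}
    (h₁ : (e.functor.map f).1 ≫ (e.glueFst X Y).hom = (e.functor.map g).1 ≫ (e.glueFst X Y).hom)
    (h₂ : (e.functor.map f).2 ≫ (e.glueSnd X Y).hom = (e.functor.map g).2 ≫ (e.glueSnd X Y).hom) :
    f = g :=
  hom_ext_prod (e := e) ((cancel_mono _).1 h₁) ((cancel_mono _).1 h₂)

/-- The band induced by an equivalence with a product. -/
@[simps obj map]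
noncomputable def band : RectBand C where
  obj := e.glue
  map := e.glueMap
  map_id X Y := e.hom_ext_glue (by simp) (by simp)
  map_comp f f' g g' := e.hom_ext_glue (by simp) (by simp)
  α X Y Z W := isoOfComponents (e.glueFst _ _ ≪≫ e.glueFst X Y ≪≫ (e.glueFst X W).symm)
    (e.glueSnd _ _ ≪≫ e.glueSnd Z W ≪≫ (e.glueSnd X W).symm)
  α_naturality f g h k := e.hom_ext_glue (by simp) (by simp)
  υ X := isoOfComponents (e.glueFst X X).symm (e.glueSnd X X).symm
  υ_naturality f := e.hom_ext_glue (by simp) (by simp)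
  υ_α X Y := e.hom_ext_glue (by simp) (by simp)
  map_υ_α X Y :=
    e.hom_ext_glue (by simp) (by simp)

/-- This is the coherence condition omitted from `RectBand`. On each component both sides are the
same composite of counit comparisons. -/
lemma band_α_α (X₁ X₂ X₃ X₄ X₅ X₆ X₇ X₈ : C) :
    e.band.map (e.band.α X₁ X₂ X₃ X₄).hom (e.band.α X₅ X₆ X₇ X₈).hom ≫
        (e.band.α X₁ X₄ X₅ X₈).hom =
      (e.band.α (e.glue X₁ X₂) (e.glue X₃ X₄) (e.glue X₅ X₆) (e.glue X₇ X₈)).hom ≫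
        (e.band.α X₁ X₂ X₇ X₈).hom :=
  e.hom_ext_glue (by simp [band]) (by simp [band])

instance : e.band.Splits e where
  left := ⟨fun X Y Y' g => by
    have h := e.glueMap_fst (𝟙 X) g
    rw [map_id_fst, Category.comp_id, ← Iso.eq_comp_inv] at h
    change IsIso (e.functor.map (e.glueMap (𝟙 X) g)).1
    rw [h]
    infer_instance⟩
  right := ⟨fun X Y Y' g => by
    have h := e.glueMap_snd g (𝟙 X)
    rw [map_id_snd, Category.comp_id, ← Iso.eq_comp_inv] at h
    change IsIso (e.functor.map (e.glueMap g (𝟙 X))).2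
    rw [h]
    infer_instance⟩

end CategoryTheory.Equivalence

end BandOfEquivalence

/-! ### Functors compatible with decompositions -/

section Preservation

namespace CategoryTheory.Equivalence

variable {C : Type u} [Category.{v} C] {A : Type u₂} [Category.{v₂} A] {B : Type u₃}
  [Category.{v₃} B] {D : Type u₁} [Category.{v₁} D] {A' : Type w₁} [Category.{w₂} A']
  {B' : Type w₃} [Category.{w} B']

/-- A functor is compatible with equivalences with products if it preserves the morphisms inverted
by the first projection and those inverted by the second projection. -/
structure Compatible (e : C ≌ A × B) (e' : D ≌ A' × B') (G : C ⥤ D) : Prop where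
  fst {X Y : C} (f : X ⟶ Y) : IsIso (e.functor.map f).1 → IsIso (e'.functor.map (G.map f)).1
  snd {X Y : C} (f : X ⟶ Y) : IsIso (e.functor.map f).2 → IsIso (e'.functor.map (G.map f)).2

variable {e : C ≌ A × B} {e' : D ≌ A' × B'} {G : C ⥤ D}

lemma Compatible.isLeft (h : Compatible e e' G) (R : RectBand C) [hR : R.Splits e] :
    R.IsLeft (G ⋙ e'.functor ⋙ CategoryTheory.Prod.fst A' B') :=
  ⟨fun X _ _ g => h.fst (R.map (𝟙 X) g) (hR.left.isIso X g)⟩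

lemma Compatible.isRight (h : Compatible e e' G) (R : RectBand C) [hR : R.Splits e] :
    R.swap.IsLeft (G ⋙ e'.functor ⋙ CategoryTheory.Prod.snd A' B') :=
  ⟨fun X _ _ g => h.snd (R.map g (𝟙 X)) (hR.right.isIso X g)⟩

/-- Leftness speaks only of the morphisms `X·g`; `IsLeft.isIso_map` extends it to all morphisms
inverted by the first projection, since the two projections are jointly conservative. -/
lemma compatible_of_isLeft (hC : IsBiQuasiPointed C) (R : RectBand C) [R.Splits e]
    [R.IsLeft (G ⋙ e'.functor ⋙ CategoryTheory.Prod.fst A' B')]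
    [R.swap.IsLeft (G ⋙ e'.functor ⋙ CategoryTheory.Prod.snd A' B')] : Compatible e e' G := by
  obtain ⟨J, ⟨hJ⟩⟩ := hC.exists_terminal
  have : R.swap.swap.IsLeft (e.functor ⋙ CategoryTheory.Prod.fst A B) :=
    inferInstanceAs (R.IsLeft (e.functor ⋙ CategoryTheory.Prod.fst A B))
  exact ⟨fun f hf => RectBand.IsLeft.isIso_map R hJ (e.functor ⋙ CategoryTheory.Prod.fst A B)
      (e.functor ⋙ CategoryTheory.Prod.snd A B) (fun f h₁ h₂ => (e.isIso_iff f).2 ⟨h₁, h₂⟩)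
      (G ⋙ e'.functor ⋙ CategoryTheory.Prod.fst A' B') f hf,
    fun f hf => RectBand.IsLeft.isIso_map R.swap hJ (e.functor ⋙ CategoryTheory.Prod.snd A B)
      (e.functor ⋙ CategoryTheory.Prod.fst A B) (fun f h₁ h₂ => (e.isIso_iff f).2 ⟨h₂, h₁⟩)
      (G ⋙ e'.functor ⋙ CategoryTheory.Prod.snd A' B') f hf⟩

/-- An object is torsion exactly when the second component of `0 ⟶ X` is invertible, and `G`
preserves both `0` and this invertibility. -/
lemma Compatible.map_tors (h : Compatible e e' G) (hC : IsBiQuasiPointed C)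
    (hG : ∀ X, initialObjects C X → initialObjects D (G.obj X)) (X : C) (hX : e.tors X) :
    e'.tors (G.obj X) := by
  obtain ⟨I, hI⟩ := hC.exists_initial
  have h₁ {K : D} (hK : initialObjects D K) : initialObjects B' (e'.functor.obj K).2 :=
    ((initialObjects_prod_iff _).1 (initialObjects_equivalence e' hK)).2
  have h₂ := ((initialObjects_prod_iff _).1 (initialObjects_equivalence e hI)).2
  have := h.snd (hI.some.to X) (isIso_of_initialObjects h₂ hX _)
  exact initialObjects_of_iso (asIso (e'.functor.map (G.map (hI.some.to X))).2) (h₁ (hG I hI))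

lemma Compatible.map_free (h : Compatible e e' G) (hC : IsBiQuasiPointed C)
    (hG : ∀ X, terminalObjects C X → terminalObjects D (G.obj X)) (X : C) (hX : e.free X) :
    e'.free (G.obj X) := by
  obtain ⟨J, hJ⟩ := hC.exists_terminal
  have h₁ {K : D} (hK : terminalObjects D K) : terminalObjects A' (e'.functor.obj K).1 :=
    ((terminalObjects_prod_iff _).1 (terminalObjects_equivalence e' hK)).1
  have h₂ := ((terminalObjects_prod_iff _).1 (terminalObjects_equivalence e hJ)).1
  have := h.fst (hJ.some.from X) (isIso_of_terminalObjects hX h₂ _)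
  exact terminalObjects_of_iso (asIso (e'.functor.map (G.map (hJ.some.from X))).1).symm
    (h₁ (hG J hJ))

/-- An equivalence with a product of bi-quasi-pointed categories presents a pretorsion theory if
it has the same torsion and torsion-free objects as the theory of the product. -/
structure Presents (e : C ≌ A × B) (P : PretorsionTheory C) : Prop where
  left : IsBiQuasiPointed A
  right : IsBiQuasiPointed B
  tors_eq : P.tors = e.tors
  free_eq : P.free = e.free

lemma Presents.isShortExact_iff {P : PretorsionTheory C} (h : e.Presents P) {T X F : C}
    {l : T ⟶ X} {r : X ⟶ F} (hT : P.tors T) (hF : P.free F) :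
    IsShortExact P.null l r ↔ IsIso (e.functor.map l).1 ∧ IsIso (e.functor.map r).2 := by
  rw [h.tors_eq] at hT
  rw [h.free_eq] at hF
  rw [PretorsionTheory.null, h.tors_eq, h.free_eq,
    CategoryTheory.Equivalence.isShortExact_iff h.left h.right hT hF]

/-- If `f` has invertible first component, so does its torsion part `P.torsMap f`, which is then an
isomorphism because its second component joins initial objects. Hence `G` keeps it invertible, and
exactness of the image sequences carries invertibility of the first component back to `G.map f`.
Torsion-free parts treat the second component. -/
lemma Presents.compatible {P : PretorsionTheory C} {Q : PretorsionTheory D} (h : e.Presents P)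
    (h' : e'.Presents Q) (ht : ∀ X, P.tors X → Q.tors (G.obj X))
    (hf : ∀ X, P.free X → Q.free (G.obj X))
    (hG : ∀ X, IsShortExact Q.null (G.map (P.ℓ X)) (G.map (P.r X))) : Compatible e e' G := by
  have hT (X : C) : e.tors (P.torsPart X) := h.tors_eq ▸ P.tors_torsPart X
  have hF (X : C) : e.free (P.freePart X) := h.free_eq ▸ P.free_freePart X
  have h₁ (X : C) := (h.isShortExact_iff (P.tors_torsPart X) (P.free_freePart X)).1 (P.exact X)
  have h₂ (X : C) := (h'.isShortExact_iff (ht _ (P.tors_torsPart X))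
    (hf _ (P.free_freePart X))).1 (hG X)
  have l₁ (X : C) := (h₁ X).1
  have r₁ (X : C) := (h₁ X).2
  have l₂ (X : C) := (h₂ X).1
  have r₂ (X : C) := (h₂ X).2
  constructor
  · intro X Y f hf
    have : IsIso (e.functor.map (P.torsMap f)).1 := by
      have := congrArg (fun k => (e.functor.map k).1) (P.torsMap_ℓ f)
      simp only [map_comp_fst] at this
      rw [← IsIso.eq_comp_inv] at this
      rw [this]; infer_instance
    have : IsIso (P.torsMap f) :=
      (e.isIso_iff _).2 ⟨this, isIso_of_initialObjects (hT X) (hT Y) _⟩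
    have := ((e'.isIso_iff (G.map (P.torsMap f))).1 inferInstance).1
    have h := congrArg (fun k => (e'.functor.map (G.map k)).1) (P.torsMap_ℓ f)
    simp only [G.map_comp, map_comp_fst] at h
    rw [← IsIso.inv_comp_eq] at h
    rw [← h]; infer_instance
  · intro X Y f hf
    have : IsIso (e.functor.map (P.freeMap f)).2 := by
      have := congrArg (fun k => (e.functor.map k).2) (P.r_freeMap f)
      simp only [map_comp_snd] at this
      rw [← IsIso.eq_inv_comp] at this
      rw [this]; infer_instance
    have : IsIso (P.freeMap f) :=
      (e.isIso_iff _).2 ⟨isIso_of_terminalObjects (hF X) (hF Y) _, this⟩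
    have := ((e'.isIso_iff (G.map (P.freeMap f))).1 inferInstance).2
    have h := congrArg (fun k => (e'.functor.map (G.map k)).2) (P.r_freeMap f)
    simp only [G.map_comp, map_comp_snd] at h
    rw [← IsIso.comp_inv_eq] at h
    rw [← h]; infer_instance

lemma presents_pretorsionTheory (e : C ≌ A × B) (hA : IsBiQuasiPointed A)
    (hB : IsBiQuasiPointed B) : e.Presents (e.pretorsionTheory hA hB) :=
  ⟨hA, hB, rfl, rfl⟩

end CategoryTheory.Equivalence

lemma PretorsionTheory.IsSymmetrical.exists_presents {C : Type u} [Category.{v} C]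
    {P : PretorsionTheory C} (h : P.IsSymmetrical) :
    ∃ (A B : Type u) (_ : Category.{v} A) (_ : Category.{v} B), ∃ e : C ≌ A × B,
      e.Presents P := by
  obtain ⟨A, B, _, _, hA, hB, e, he⟩ := h
  exact ⟨A, B, _, _, e, hA, hB, he.tors_eq, he.free_eq⟩

end Preservation

open BiQPointCat

/-! ### Pseudo-algebras and pseudo-morphisms in components -/

section Components

namespace BiQPointCat

variable {C D : BiQPointCat.{v, u}}

/-- An invertible 2-cell from its components. -/
def isoOfComponents {F G : C ⟶ D} (i : ∀ X, (Hom.functor F).obj X ≅ (Hom.functor G).obj X)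
    (h : ∀ {X Y : C.carrier} (f : X ⟶ Y),
      (Hom.functor F).map f ≫ (i Y).hom = (i X).hom ≫ (Hom.functor G).map f) : F ≅ G where
  hom := ({ app := fun X => (i X).hom, naturality := fun _ _ f => h f } :
    NatTrans (Hom.functor F) (Hom.functor G))
  inv := ({ app := fun X => (i X).inv
            naturality := fun X Y f => by
              rw [Iso.eq_inv_comp, ← Category.assoc, ← h, Category.assoc, Iso.hom_inv_id,
                Category.comp_id] } : NatTrans (Hom.functor G) (Hom.functor F))
  hom_inv_id := NatTrans.ext (funext fun X => (i X).hom_inv_id)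
  inv_hom_id := NatTrans.ext (funext fun X => (i X).inv_hom_id)

/-- The components of an invertible 2-cell. -/
def isoApp {F G : C ⟶ D} (i : F ≅ G) (X : C.carrier) :
    (Hom.functor F).obj X ≅ (Hom.functor G).obj X where
  hom := NatTrans.app i.hom X
  inv := NatTrans.app i.inv X
  hom_inv_id := congrArg (fun α : NatTrans _ _ => α.app X) i.hom_inv_id
  inv_hom_id := congrArg (fun α : NatTrans _ _ => α.app X) i.inv_hom_id

end BiQPointCat

namespace PseudoAlgebra

/-- The structure functor of a pseudo-algebra for the square monad. -/
def strFunctor (X : PseudoAlgebra squareMonad.{v, u}) :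
    X.carrier.carrier × X.carrier.carrier ⥤ X.carrier.carrier :=
  BiQPointCat.Hom.functor X.str

/-- The components of the associativity isomorphism. -/
def assocApp (X : PseudoAlgebra squareMonad.{v, u}) (A B A' B' : X.carrier.carrier) :
    X.strFunctor.obj (X.strFunctor.obj (A, B), X.strFunctor.obj (A', B')) ≅
      X.strFunctor.obj (A, B') :=
  isoApp X.assoc ((A, B), (A', B'))

/-- The components of the unit isomorphism. -/
def unitApp (X : PseudoAlgebra squareMonad.{v, u}) (A : X.carrier.carrier) :
    A ≅ X.strFunctor.obj (A, A) :=
  isoApp X.unit A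

/-- The components of a pseudo-algebra for the square monad. -/
def toBand (X : PseudoAlgebra squareMonad.{v, u}) : RectBand X.carrier.carrier where
  obj A B := X.strFunctor.obj (A, B)
  map {A A' B B'} f g := X.strFunctor.map (X := (A, B)) (Y := (A', B')) (f, g)
  map_id A B := X.strFunctor.map_id (A, B)
  map_comp {A A' A'' B B' B''} f f' g g' := X.strFunctor.map_comp
    (X := (A, B)) (Y := (A', B')) (Z := (A'', B'')) (f, g) (f', g')
  α := X.assocApp
  α_naturality {A B A' B' E F E' F'} f g h k := NatTrans.naturality X.assoc.hom
    (X := ((A, B), (A', B'))) (Y := ((E, F), (E', F'))) ((f, g), (h, k))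
  υ := X.unitApp
  υ_naturality f := NatTrans.naturality X.unit.hom f
  υ_α A B := by
    have h := congrArg (fun α : NatTrans _ _ => α.app (A, B)) X.unit_left_coh
    -- The equalities of 1-cells in the coherence axioms hold definitionally here, so their
    -- `eqToHom`s have identity components.
    change (X.unitApp (X.strFunctor.obj (A, B))).hom ≫ 𝟙 _ ≫ (X.assocApp A B A B).hom = 𝟙 _ at h
    rwa [Category.id_comp] at h
  map_υ_α A B := by
    have h := congrArg (fun α : NatTrans _ _ => α.app (A, B)) X.unit_right_coh
    change X.strFunctor.map (X := (A, B)) ((X.unitApp A).hom, (X.unitApp B).hom) ≫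
      𝟙 _ ≫ (X.assocApp A A B B).hom = 𝟙 _ at h
    rwa [Category.id_comp] at h

/-- The pseudo-algebra with given components. -/
def ofBand (C : BiQPointCat.{v, u}) (R : RectBand C.carrier)
    (hα : ∀ X₁ X₂ X₃ X₄ X₅ X₆ X₇ X₈ : C.carrier,
      R.map (R.α X₁ X₂ X₃ X₄).hom (R.α X₅ X₆ X₇ X₈).hom ≫ (R.α X₁ X₄ X₅ X₈).hom =
        (R.α (R.obj X₁ X₂) (R.obj X₃ X₄) (R.obj X₅ X₆) (R.obj X₇ X₈)).hom ≫
          (R.α X₁ X₂ X₇ X₈).hom) :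
    PseudoAlgebra squareMonad.{v, u} where
  carrier := C
  str :=
    { functor :=
        { obj := fun K => R.obj K.1 K.2
          map := fun f => R.map f.1 f.2
          map_id := fun K => R.map_id K.1 K.2
          map_comp := fun f g => R.map_comp f.1 g.1 f.2 g.2 }
      map_initial := fun K h => by
        obtain ⟨h₁, h₂⟩ := (initialObjects_prod_iff K).1 h
        -- The product of initial objects `K.1·K.2` is initial because `K.1 ≅ K.1·K.1 ≅ K.1·K.2`.
        have := isIso_of_initialObjects h₁ h₂ (h₁.some.to _)
        exact initialObjects_of_iso (R.υ K.1 ≪≫ asIso (R.map (𝟙 K.1) (h₁.some.to K.2))) h₁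
      map_terminal := fun K h => by
        obtain ⟨h₁, h₂⟩ := (terminalObjects_prod_iff K).1 h
        have := isIso_of_terminalObjects h₁ h₂ (h₂.some.from _)
        exact terminalObjects_of_iso (R.υ K.1 ≪≫ asIso (R.map (𝟙 K.1) (h₂.some.from K.1))) h₁ }
  assoc := isoOfComponents (fun K => R.α K.1.1 K.1.2 K.2.1 K.2.2)
    (fun f => R.α_naturality f.1.1 f.1.2 f.2.1 f.2.2)
  unit := isoOfComponents R.υ (fun f => R.υ_naturality f)
  assoc_coh := NatTrans.ext (funext fun K => by
    have h := hα K.1.1.1 K.1.1.2 K.1.2.1 K.1.2.2 K.2.1.1 K.2.1.2 K.2.2.1 K.2.2.2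
    change R.map (R.α K.1.1.1 K.1.1.2 K.1.2.1 K.1.2.2).hom
        (R.α K.2.1.1 K.2.1.2 K.2.2.1 K.2.2.2).hom ≫ 𝟙 _ ≫
        (R.α K.1.1.1 K.1.2.2 K.2.1.1 K.2.2.2).hom ≫ 𝟙 _ =
      𝟙 _ ≫ (R.α _ _ _ _).hom ≫ 𝟙 _ ≫ (R.α K.1.1.1 K.1.1.2 K.2.2.1 K.2.2.2).hom
    rw [Category.id_comp, Category.id_comp, Category.id_comp, Category.comp_id]
    exact h)
  unit_left_coh := NatTrans.ext (funext fun K => by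
    change (R.υ (R.obj K.1 K.2)).hom ≫ 𝟙 _ ≫ (R.α K.1 K.2 K.1 K.2).hom = 𝟙 _
    rw [Category.id_comp]
    exact R.υ_α K.1 K.2)
  unit_right_coh := NatTrans.ext (funext fun K => by
    change R.map (R.υ K.1).hom (R.υ K.2).hom ≫ 𝟙 _ ≫ (R.α K.1 K.1 K.2 K.2).hom = 𝟙 _
    rw [Category.id_comp]
    exact R.map_υ_α K.1 K.2)

end PseudoAlgebra

namespace PseudoMorphism

variable {X Y : PseudoAlgebra squareMonad.{v, u}}

/-- The components of the invertible 2-cell of a pseudo-morphism. -/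
def bandIso (F : PseudoMorphism X Y) (A B : X.carrier.carrier) :
    Y.toBand.obj ((BiQPointCat.Hom.functor F.hom).obj A) ((BiQPointCat.Hom.functor F.hom).obj B) ≅
      (BiQPointCat.Hom.functor F.hom).obj (X.toBand.obj A B) :=
  isoApp F.iso (A, B)

/-- The components of a pseudo-morphism for the square monad. -/
def toBandHom (F : PseudoMorphism X Y) :
    RectBand.Hom X.toBand Y.toBand (BiQPointCat.Hom.functor F.hom) where
  iso := F.bandIso
  naturality {A B A' B'} f g := NatTrans.naturality F.iso.hom (X := (A, B)) (Y := (A', B')) (f, g)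
  assoc A B A' B' := by
    have h := congrArg (fun α : NatTrans _ _ => α.app ((A, B), (A', B'))) F.assoc_coh
    change Y.toBand.map (F.bandIso A B).hom (F.bandIso A' B').hom ≫ 𝟙 _ ≫
        (F.bandIso (X.toBand.obj A B) (X.toBand.obj A' B')).hom ≫ 𝟙 _ ≫
          (BiQPointCat.Hom.functor F.hom).map (X.toBand.α A B A' B').hom =
      𝟙 _ ≫ (Y.toBand.α _ _ _ _).hom ≫ 𝟙 _ ≫ (F.bandIso A B').hom ≫ 𝟙 _ at h
    rwa [Category.id_comp, Category.id_comp, Category.id_comp, Category.id_comp,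
      Category.comp_id] at h
  unit A := by
    have h := congrArg (fun α : NatTrans _ _ => α.app A) F.unit_coh
    change (Y.toBand.υ _).hom ≫ 𝟙 _ ≫ (F.bandIso A A).hom =
      𝟙 _ ≫ (BiQPointCat.Hom.functor F.hom).map (X.toBand.υ A).hom ≫ 𝟙 _ at h
    rwa [Category.id_comp, Category.id_comp, Category.comp_id] at h

/-- The pseudo-morphism with given components. -/
def ofBandHom (G : X.carrier ⟶ Y.carrier)
    (θ : RectBand.Hom X.toBand Y.toBand (BiQPointCat.Hom.functor G)) : PseudoMorphism X Y where
  hom := G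
  iso := isoOfComponents (fun K => θ.iso K.1 K.2) (fun f => θ.naturality f.1 f.2)
  assoc_coh := NatTrans.ext (funext fun K => by
    have h := θ.assoc K.1.1 K.1.2 K.2.1 K.2.2
    change Y.toBand.map (θ.iso K.1.1 K.1.2).hom (θ.iso K.2.1 K.2.2).hom ≫ 𝟙 _ ≫
        (θ.iso (X.toBand.obj K.1.1 K.1.2) (X.toBand.obj K.2.1 K.2.2)).hom ≫ 𝟙 _ ≫
          (BiQPointCat.Hom.functor G).map (X.toBand.α K.1.1 K.1.2 K.2.1 K.2.2).hom =
      𝟙 _ ≫ (Y.toBand.α _ _ _ _).hom ≫ 𝟙 _ ≫ (θ.iso K.1.1 K.2.2).hom ≫ 𝟙 _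
    rw [Category.id_comp, Category.id_comp, Category.id_comp, Category.id_comp, Category.comp_id]
    exact h)
  unit_coh := NatTrans.ext (funext fun A => by
    have h := θ.unit A
    change (Y.toBand.υ _).hom ≫ 𝟙 _ ≫ (θ.iso A A).hom =
      𝟙 _ ≫ (BiQPointCat.Hom.functor G).map (X.toBand.υ A).hom ≫ 𝟙 _
    rw [Category.id_comp, Category.id_comp, Category.comp_id]
    exact h)

/-- Consequence of `iso_eq`. It lets every equation between pseudo-morphisms be checked on
underlying functors, which makes the strict functoriality and 2-naturality below immediate even
though the structure isomorphisms are obtained by choice. -/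
lemma ext_of_hom_eq {F G : PseudoMorphism X Y} (h : F.hom = G.hom) : F = G := by
  refine hom_ext h (TwoCell.of_hom_ext (by rw [h]) (by rw [h]) ?_)
  obtain ⟨F, φ, h₁, h₂⟩ := F
  obtain ⟨G, ψ, h₃, h₄⟩ := G
  dsimp only at h
  subst h
  simp only [eqToHom_refl, Category.comp_id, Category.id_comp]
  exact NatTrans.ext (funext fun K => RectBand.Hom.iso_eq X.carrier.isBiQuasiPointed
    Y.carrier.isBiQuasiPointed (toBandHom ⟨F, φ, h₁, h₂⟩) (toBandHom ⟨F, ψ, h₃, h₄⟩) K.1 K.2)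

/-- A 2-cell of bi-quasi-pointed categories as a 2-cell of pseudo-morphisms. -/
def twoCell {F G : PseudoMorphism X Y} (τ : F.hom ⟶ G.hom) : PseudoTwoCell F G where
  cell := τ
  comm := NatTrans.ext (funext fun K => RectBand.Hom.comm X.carrier.isBiQuasiPointed
    Y.carrier.isBiQuasiPointed F.toBandHom G.toBandHom τ K.1 K.2)

end PseudoMorphism

end Components

/-! ### Bands and pretorsion theories sharing a decomposition -/

section Association

variable {C : Type u} [Category.{v} C] {D : Type u} [Category.{v} D]

/-- The conditions on a functor to be a morphism of pretorsion theories. -/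
structure PretorsionTheory.IsHom (P : PretorsionTheory C) (Q : PretorsionTheory D)
    (G : C ⥤ D) : Prop where
  map_tors (X : C) : P.tors X → Q.tors (G.obj X)
  map_free (X : C) : P.free X → Q.free (G.obj X)
  map_exact (X : C) : IsShortExact Q.null (G.map (P.ℓ X)) (G.map (P.r X))

lemma PretorsionTheory.IsHom.id (P : PretorsionTheory C) : P.IsHom P (𝟭 C) :=
  ⟨fun _ h => h, fun _ h => h, P.exact⟩

/-- The identity functor as a morphism of bands. -/
def RectBand.Hom.id (R : RectBand C) : RectBand.Hom R R (𝟭 C) where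
  iso X Y := Iso.refl _
  naturality f g := (Category.comp_id _).trans (Category.id_comp _).symm
  assoc X Y Z W := by
    change R.map (𝟙 _) (𝟙 _) ≫ 𝟙 _ ≫ (R.α X Y Z W).hom = (R.α X Y Z W).hom ≫ 𝟙 _
    rw [R.map_id, Category.id_comp, Category.id_comp, Category.comp_id]
  unit X := Category.comp_id _

/-- A band and a pretorsion theory are associated if an equivalence with a product splits the
band and presents the theory. -/
def RectBand.Associated (R : RectBand C) (P : PretorsionTheory C) : Prop :=
  ∃ (A B : Type u) (_ : Category.{v} A) (_ : Category.{v} B), ∃ e : C ≌ A × B,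
    R.Splits e ∧ e.Presents P

namespace RectBand.Associated

variable {R : RectBand C} {S : RectBand D} {P : PretorsionTheory C} {Q : PretorsionTheory D}
  {G : C ⥤ D}

/-- A band morphism makes the composites of `G` with the two projections left and right, so `G` is
compatible with the decompositions; preservation of torsion, torsion-free objects and short exact
sequences is then read off on components. -/
lemma isHom (h : R.Associated P) (h' : S.Associated Q) (hC : IsBiQuasiPointed C)
    (h₀ : ∀ X, initialObjects C X → initialObjects D (G.obj X))
    (h₁ : ∀ X, terminalObjects C X → terminalObjects D (G.obj X)) (θ : RectBand.Hom R S G) :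
    P.IsHom Q G := by
  obtain ⟨A, B, _, _, e, hR, hP⟩ := h
  obtain ⟨A', B', _, _, e', hS, hQ⟩ := h'
  have := θ.isLeft_comp (e'.functor ⋙ CategoryTheory.Prod.fst A' B')
  have := θ.swap.isLeft_comp (e'.functor ⋙ CategoryTheory.Prod.snd A' B')
  have hG : Equivalence.Compatible e e' G := Equivalence.compatible_of_isLeft hC R
  have ht (X : C) (hX : P.tors X) : Q.tors (G.obj X) := by
    rw [hQ.tors_eq]
    rw [hP.tors_eq] at hX
    exact hG.map_tors hC h₀ X hX
  have hf (X : C) (hX : P.free X) : Q.free (G.obj X) := by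
    rw [hQ.free_eq]
    rw [hP.free_eq] at hX
    exact hG.map_free hC h₁ X hX
  refine ⟨ht, hf, fun X => ?_⟩
  have hX := (hP.isShortExact_iff (P.tors_torsPart X) (P.free_freePart X)).1 (P.exact X)
  exact (hQ.isShortExact_iff (ht _ (P.tors_torsPart X)) (hf _ (P.free_freePart X))).2
    ⟨hG.fst _ hX.1, hG.snd _ hX.2⟩

/-- Converse of `isHom`: preservation of the chosen sequences gives compatibility, which provides
the left and right functors from which `ofIsLeft` builds the structure. -/
lemma nonempty_hom (h : R.Associated P) (h' : S.Associated Q) (hC : IsBiQuasiPointed C)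
    (hD : IsBiQuasiPointed D) (hG : P.IsHom Q G) : Nonempty (RectBand.Hom R S G) := by
  obtain ⟨A, B, _, _, e, hR, hP⟩ := h
  obtain ⟨A', B', _, _, e', hS, hQ⟩ := h'
  obtain ⟨J, ⟨hJ⟩⟩ := hC.exists_terminal
  obtain ⟨J', ⟨hJ'⟩⟩ := hD.exists_terminal
  have hc : Equivalence.Compatible e e' G :=
    hP.compatible hQ hG.map_tors hG.map_free hG.map_exact
  have := hc.isLeft R
  have := hc.isRight R
  exact ⟨RectBand.Hom.ofIsLeft R S G e' hJ hJ'⟩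

end RectBand.Associated

/-- A decomposition that splits the band carries its own product pretorsion theory. -/
lemma RectBand.exists_associated (R : RectBand C) (hC : IsBiQuasiPointed C) :
    ∃ P : PretorsionTheory C, P.IsRectangular ∧ P.IsSymmetrical ∧ R.Associated P := by
  obtain ⟨A, B, _, _, hA, hB, e, he⟩ := R.exists_splits hC
  exact ⟨e.pretorsionTheory hA hB, e.isRectangular_pretorsionTheory hA hB,
    isSymmetrical_pretorsionTheory e hA hB, A, B, _, _, e, he,
    e.presents_pretorsionTheory hA hB⟩

end Association

/-- The decomposition given by symmetry carries a band, and this band satisfies the full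
associativity coherence by `band_α_α`. -/
lemma PTorSR.exists_pseudoAlgebra (P : PTorSR.{v, u}) :
    ∃ (R : RectBand P.carrier) (_ : ∀ X₁ X₂ X₃ X₄ X₅ X₆ X₇ X₈ : P.carrier,
      R.map (R.α X₁ X₂ X₃ X₄).hom (R.α X₅ X₆ X₇ X₈).hom ≫ (R.α X₁ X₄ X₅ X₈).hom =
        (R.α (R.obj X₁ X₂) (R.obj X₃ X₄) (R.obj X₅ X₆) (R.obj X₇ X₈)).hom ≫
          (R.α X₁ X₂ X₇ X₈).hom), R.Associated P.theory := by
  obtain ⟨A, B, _, _, e, he⟩ := P.isSymmetrical.exists_presents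
  exact ⟨e.band, e.band_α_α, A, B, _, _, e, inferInstance, he⟩

/-! ### From pseudo-algebras to pretorsion theories -/

section PseudoAlgebraToTheory

namespace PseudoAlgebra

/-- The pretorsion theory of a pseudo-algebra for the square monad. -/
noncomputable def theory (X : PseudoAlgebra squareMonad.{v, u}) :
    PretorsionTheory X.carrier.carrier :=
  (X.toBand.exists_associated X.carrier.isBiQuasiPointed).choose

lemma associated_theory (X : PseudoAlgebra squareMonad.{v, u}) :
    X.toBand.Associated X.theory :=
  (X.toBand.exists_associated X.carrier.isBiQuasiPointed).choose_spec.2.2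

/-- The symmetrical rectangular pretorsion theory of a pseudo-algebra for the square monad. -/
noncomputable def toPTorSR (X : PseudoAlgebra squareMonad.{v, u}) : PTorSR.{v, u} where
  carrier := X.carrier.carrier
  category := X.carrier.category
  theory := X.theory
  isRectangular := (X.toBand.exists_associated X.carrier.isBiQuasiPointed).choose_spec.1
  isSymmetrical := (X.toBand.exists_associated X.carrier.isBiQuasiPointed).choose_spec.2.1

end PseudoAlgebra

/-- A morphism of symmetrical rectangular pretorsion theories from its underlying functor. -/
def PTorSR.homMk {P Q : PTorSR.{v, u}} (G : P.toBiQPointCat ⟶ Q.toBiQPointCat)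
    (hG : P.theory.IsHom Q.theory (BiQPointCat.Hom.functor G)) : P ⟶ Q :=
  ({ toHom := G
     map_tors := hG.map_tors
     map_free := hG.map_free
     map_exact := hG.map_exact } : PTorSR.Hom P Q)

/-- The morphism of pretorsion theories underlying a pseudo-morphism. -/
noncomputable def PseudoMorphism.toPTorSRHom {X Y : PseudoAlgebra squareMonad.{v, u}}
    (F : PseudoMorphism X Y) : X.toPTorSR ⟶ Y.toPTorSR :=
  PTorSR.homMk (P := X.toPTorSR) (Q := Y.toPTorSR) F.hom
    (X.associated_theory.isHom Y.associated_theory X.carrier.isBiQuasiPointed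
      (BiQPointCat.Hom.map_initial F.hom) (BiQPointCat.Hom.map_terminal F.hom) F.toBandHom)

/-- The 2-functor from pseudo-algebras to symmetrical rectangular pretorsion theories. -/
noncomputable def PseudoAlgebra.ξ :
    StrictPseudofunctor (PseudoAlgebra squareMonad.{v, u}) PTorSR.{v, u} :=
  StrictPseudofunctor.mk''
    { obj := PseudoAlgebra.toPTorSR
      map := PseudoMorphism.toPTorSRHom
      map₂ := PseudoTwoCell.cell
      map₂_id := fun _ => rfl
      map₂_comp := fun _ _ => rfl
      map_id := fun _ => rfl
      map_comp := fun _ _ => rfl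
      map₂_whisker_left := fun _ _ _ _ =>
        ((Category.id_comp _).trans (Category.comp_id _)).symm
      map₂_whisker_right := fun _ _ =>
        ((Category.id_comp _).trans (Category.comp_id _)).symm }

end PseudoAlgebraToTheory

/-! ### From pretorsion theories to pseudo-algebras -/

section TheoryToPseudoAlgebra

namespace PseudoAlgebra

variable {X Y : PseudoAlgebra squareMonad.{v, u}} {F G F' G' : X ⟶ Y}

/-- Equal pseudo-morphisms need not be definitionally equal, but their underlying functors below
are; this moves an equation with `eqToHom`s down to underlying 2-cells. -/
lemma eq_conj_eqToHom {τ : F ⟶ G} {σ : F' ⟶ G'} (h : F = F') (h' : G' = G)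
    (e : PseudoTwoCell.cell τ = eqToHom (congrArg PseudoMorphism.hom h) ≫
      PseudoTwoCell.cell σ ≫ eqToHom (congrArg PseudoMorphism.hom h')) :
    τ = eqToHom h ≫ σ ≫ eqToHom h' := by
  subst h h'
  exact PseudoTwoCell.ext e

lemma comp_eqToHom_eq {τ : F ⟶ G} {σ : F' ⟶ G'} (h : F = F') (h' : G = G')
    (e : PseudoTwoCell.cell τ ≫ eqToHom (congrArg PseudoMorphism.hom h') =
      eqToHom (congrArg PseudoMorphism.hom h) ≫ PseudoTwoCell.cell σ) :
    τ ≫ eqToHom h' = eqToHom h ≫ σ := by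
  subst h h'
  exact PseudoTwoCell.ext e

end PseudoAlgebra

namespace PTorSR

/-- The pseudo-algebra of a symmetrical rectangular pretorsion theory. -/
noncomputable def toPseudoAlgebra (P : PTorSR.{v, u}) : PseudoAlgebra squareMonad.{v, u} :=
  PseudoAlgebra.ofBand P.toBiQPointCat P.exists_pseudoAlgebra.choose
    P.exists_pseudoAlgebra.choose_spec.choose

lemma associated_toPseudoAlgebra (P : PTorSR.{v, u}) :
    RectBand.Associated P.toPseudoAlgebra.toBand P.theory :=
  P.exists_pseudoAlgebra.choose_spec.choose_spec

lemma isHom {P Q : PTorSR.{v, u}} (F : P ⟶ Q) :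
    P.theory.IsHom Q.theory (BiQPointCat.Hom.functor (toBiQPointHom F)) :=
  ⟨Hom.map_tors F, Hom.map_free F, Hom.map_exact F⟩

/-- A pseudo-morphism between pseudo-algebras associated to pretorsion theories. -/
noncomputable def pseudoMorphismOf {X Y : PseudoAlgebra squareMonad.{v, u}}
    {P : PretorsionTheory X.carrier.carrier} {Q : PretorsionTheory Y.carrier.carrier}
    (hX : X.toBand.Associated P) (hY : Y.toBand.Associated Q) (G : X.carrier ⟶ Y.carrier)
    (hG : P.IsHom Q (BiQPointCat.Hom.functor G)) : PseudoMorphism X Y :=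
  PseudoMorphism.ofBandHom G
    (hX.nonempty_hom hY X.carrier.isBiQuasiPointed Y.carrier.isBiQuasiPointed hG).some

/-- The pseudo-morphism underlying a morphism of pretorsion theories. -/
noncomputable def Hom.toPseudoMorphism {P Q : PTorSR.{v, u}} (F : P ⟶ Q) :
    PseudoMorphism P.toPseudoAlgebra Q.toPseudoAlgebra :=
  pseudoMorphismOf (X := P.toPseudoAlgebra) (Y := Q.toPseudoAlgebra)
    P.associated_toPseudoAlgebra Q.associated_toPseudoAlgebra (toBiQPointHom F) (isHom F)

/-- The 2-functor from symmetrical rectangular pretorsion theories to pseudo-algebras. -/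
noncomputable def χ : StrictPseudofunctor PTorSR.{v, u} (PseudoAlgebra squareMonad.{v, u}) :=
  StrictPseudofunctor.mk''
    { obj := toPseudoAlgebra
      map := fun F => Hom.toPseudoMorphism F
      map₂ := fun {_ _ F G} τ => PseudoMorphism.twoCell (F := Hom.toPseudoMorphism F)
        (G := Hom.toPseudoMorphism G) τ
      map₂_id := fun _ => PseudoTwoCell.ext rfl
      map₂_comp := fun _ _ => PseudoTwoCell.ext rfl
      map_id := fun _ => PseudoMorphism.ext_of_hom_eq rfl
      map_comp := fun _ _ => PseudoMorphism.ext_of_hom_eq rfl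
      map₂_whisker_left := fun _ _ _ _ => PseudoAlgebra.eq_conj_eqToHom _ _
        ((Category.id_comp _).trans (Category.comp_id _)).symm
      map₂_whisker_right := fun _ _ => PseudoAlgebra.eq_conj_eqToHom _ _
        ((Category.id_comp _).trans (Category.comp_id _)).symm }

end PTorSR

end TheoryToPseudoAlgebra

/-! ### The 2-equivalence over bi-quasi-pointed categories -/

section Equivalence

/-- In a strict pseudofunctor the unit and composition isomorphisms are `eqToIso`s, hence determined
by the action on cells. -/
lemma StrictPseudofunctor.ext_prelax {B : Type u₁} [Bicategory.{w₁, v₁} B] {C : Type u₂}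
    [Bicategory.{w₂, v₂} C] {F G : StrictPseudofunctor B C}
    (h : F.toPrelaxFunctor = G.toPrelaxFunctor) : F = G := by
  obtain ⟨⟨⟨F, i, c, _, _, _, _, _⟩, hi, hi'⟩, hc, hc'⟩ := F
  obtain ⟨⟨⟨G, j, d, _, _, _, _, _⟩, hj, hj'⟩, hd, hd'⟩ := G
  dsimp only at h
  subst h
  obtain rfl : i = j := by
    funext X
    exact (hi' X).trans (hj' X).symm
  obtain rfl : @c = @d := by
    funext X Y Z f g
    exact (hc' f g).trans (hd' f g).symm
  rfl

/-- Two theories associated to one band may differ in their chosen short exact sequences, yet the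
identity functor is a morphism between them in both directions. This yields the components of `ξ χ ≅
1` and their inverses. -/
lemma PTorSR.isHom_id_of_associated (P : PTorSR.{v, u}) {R : RectBand P.carrier}
    {Q Q' : PretorsionTheory P.carrier} (h : R.Associated Q) (h' : R.Associated Q') :
    Q.IsHom Q' (𝟭 P.carrier) :=
  h.isHom h' P.toBiQPointCat.isBiQuasiPointed (fun _ h => h) (fun _ h => h) (RectBand.Hom.id R)

/-- The 2-natural isomorphism `ξ χ ≅ 1`. -/
noncomputable def PTorSR.unitIso :
    TwoNatIso (PTorSR.χ.comp PseudoAlgebra.ξ) (StrictPseudofunctor.id PTorSR.{v, u}) where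
  hom :=
    { app := fun P => PTorSR.homMk (P := P.toPseudoAlgebra.toPTorSR) (Q := P) (𝟙 P.toBiQPointCat)
        (P.isHom_id_of_associated P.toPseudoAlgebra.associated_theory
          P.associated_toPseudoAlgebra)
      naturality := fun _ => rfl
      naturality₂ := fun _ => (Category.comp_id _).trans (Category.id_comp _).symm }
  inv :=
    { app := fun P => PTorSR.homMk (P := P) (Q := P.toPseudoAlgebra.toPTorSR) (𝟙 P.toBiQPointCat)
        (P.isHom_id_of_associated P.associated_toPseudoAlgebra
          P.toPseudoAlgebra.associated_theory)
      naturality := fun _ => rfl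
      naturality₂ := fun _ => (Category.comp_id _).trans (Category.id_comp _).symm }
  hom_inv_id _ := rfl
  inv_hom_id _ := rfl

/-- The 2-natural isomorphism `χ ξ ≅ 1`. -/
noncomputable def PseudoAlgebra.counitIso :
    TwoNatIso (PseudoAlgebra.ξ.comp PTorSR.χ)
      (StrictPseudofunctor.id (PseudoAlgebra squareMonad.{v, u})) where
  hom :=
    -- Both pseudo-algebras are associated to `X.theory`, so the identity functor, being a morphism
    -- from this theory to itself, lifts to a pseudo-morphism between them.
    { app := fun X => PTorSR.pseudoMorphismOf (X := X.toPTorSR.toPseudoAlgebra) (Y := X)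
        X.toPTorSR.associated_toPseudoAlgebra X.associated_theory (𝟙 X.carrier)
        (PretorsionTheory.IsHom.id X.theory)
      naturality := fun _ => PseudoMorphism.ext_of_hom_eq rfl
      naturality₂ := fun _ => PseudoAlgebra.comp_eqToHom_eq _ _
        ((Category.comp_id _).trans (Category.id_comp _).symm) }
  inv :=
    { app := fun X => PTorSR.pseudoMorphismOf (X := X) (Y := X.toPTorSR.toPseudoAlgebra)
        X.associated_theory X.toPTorSR.associated_toPseudoAlgebra (𝟙 X.carrier)
        (PretorsionTheory.IsHom.id X.theory)
      naturality := fun _ => PseudoMorphism.ext_of_hom_eq rfl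
      naturality₂ := fun _ => PseudoAlgebra.comp_eqToHom_eq _ _
        ((Category.comp_id _).trans (Category.id_comp _).symm) }
  hom_inv_id _ := PseudoMorphism.ext_of_hom_eq rfl
  inv_hom_id _ := PseudoMorphism.ext_of_hom_eq rfl

/-- The 2-equivalence between symmetrical rectangular pretorsion theories and pseudo-algebras for
the square monad. -/
noncomputable def twoEquivalence : TwoEquivalenceOver PTorSR.forget.{v, u}
    (PseudoAlgebra.forget BiQPointCat.squareMonad.{v, u}) where
  functor := PTorSR.χ
  inverse := PseudoAlgebra.ξ
  functor_over := StrictPseudofunctor.ext_prelax rfl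
  inverse_over := StrictPseudofunctor.ext_prelax rfl
  unitIso := PTorSR.unitIso
  counitIso := PseudoAlgebra.counitIso
  unitIso_over _ := ⟨rfl, rfl⟩
  counitIso_over _ := ⟨rfl, rfl⟩

end Equivalence

theorem mainTheorem2 :
    Nonempty (TwoEquivalenceOver PTorSR.forget.{v, u}
      (PseudoAlgebra.forget BiQPointCat.squareMonad.{v, u})) := by
  exact ⟨twoEquivalence⟩
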